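/- Let $k$ be a field and let $1 < a < d$ be integers. Let $R = k[x^{\alpha}y^{d-\alpha} \mid \alpha \in \{0\}\cup[a,d]] \subseteq k[x,y]$, where $[a,d]$ denotes the set of integers $\alpha$ with $a \le \alpha \le d$, graded so that the generators $x^{\alpha}y^{d-\alpha}$ have degree $1$. Let $R_+ = \bigoplus_{n\ge 1} R_n$, and let $Q = (x^d, y^d)$ be the ideal of $R$ generated by $x^d$ and $y^d$. Then $R$ is a Cohen–Macaulay ring, $Q$ is a reduction of $R_+$, and $$\operatorname{reg}(R) = r_Q(R_+) = \left\lceil \frac{d-1}{d-a} \right\rceil .$$ Here $r_Q(R_+)$ is the reduction number, i.e. the least integer $r \ge 0$ with $Q (R_+)^r = (R_+)^{r+1}$. Further, $\operatorname{reg}(R)$ is the Castelnuovo–Mumford regularity: if $S = k[z_\alpha \mid \alpha \in \{0\}\cup[a,d]]$ is the standard graded polynomial ring, mapped onto $R$ by $z_\alpha \mapsto x^{\alpha}y^{d-\alpha}$, and $\cdots \to F_1 \to F_0 \to R \to 0$ is a minimal graded free resolution of $R$ over $S$, then $\operatorname{reg}(R)$ is the maximum of $b - i$ over all $i \ge 0$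 and all degrees $b$ of generators of $F_i$. -/

import Mathlib

open MvPolynomial

/-! ### Reductions of ideals -/

/-- `n` is the reduction number of the ideal `I` with respect to `J`: the ideal `J` is a reduction
of `I` (that is, `J ⊆ I` and `J * I ^ r = I ^ (r + 1)` for some `r`), and `n` is the least natural
number `r` with `J * I ^ r = I ^ (r + 1)`. -/
def IsReductionNumber {R : Type*} [CommRing R] (J I : Ideal R) (n : ℕ) : Prop :=
  J ≤ I ∧ IsLeast {r : ℕ | J * I ^ r = I ^ (r + 1)} n

/-! ### Cohen-Macaulay rings -/

/-- A Noetherian local ring is Cohen-Macaulay if its maximal ideal contains a regular sequence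
whose length is the Krull dimension of the ring (i.e. depth equals dimension). -/
def IsCohenMacaulayLocal (A : Type*) [CommRing A] [IsLocalRing A] : Prop :=
  IsNoetherianRing A ∧
    ∃ rs : List A, (∀ r ∈ rs, r ∈ IsLocalRing.maximalIdeal A) ∧
      RingTheory.Sequence.IsRegular A rs ∧ (rs.length : WithBot ℕ∞) = ringKrullDim A

/-- A ring is Cohen-Macaulay if it is Noetherian and all its localizations at prime ideals are
Cohen-Macaulay local rings. -/
def IsCohenMacaulay (R : Type*) [CommRing R] : Prop :=
  IsNoetherianRing R ∧
    ∀ (p : Ideal R) [p.IsPrime], IsCohenMacaulayLocal (Localization.AtPrime p)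

/-! ### Minimal graded free resolutions and Castelnuovo-Mumford regularity -/

/-- Let `S = k[z_s : s ∈ σ]` be a standard graded polynomial ring in finitely many variables,
`φ : S → R` a homomorphism of `k`-algebras and `𝒜 n` the component of degree `n` of `R`.
This is the structure of a minimal graded free resolution
`⋯ → F₂ → F₁ → F₀ → R → 0` of `R` as a graded `S`-module. Here `F i` is the graded free module
with a basis of `rank i` generators, the `j`-th of which has degree `deg i j`. (As `R` has no
elements of negative degree, all degrees are natural numbers; by Hilbert's syzygy theorem
`rank i = 0` holds automatically for large `i`.) -/
structure MinimalGradedFreeResolution {k σ R : Type*} [Field k] [Finite σ] [CommRing R]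
    [Algebra k R] (φ : MvPolynomial σ k →ₐ[k] R) (𝒜 : ℕ → Submodule k R) where
  /-- the rank of the `i`-th free module -/
  rank : ℕ → ℕ
  /-- the degrees of the generators of the `i`-th free module -/
  deg : (i : ℕ) → Fin (rank i) → ℕ
  /-- the differential from the `(i + 1)`-st to the `i`-th free module -/
  d : (i : ℕ) → (Fin (rank (i + 1)) → MvPolynomial σ k) →ₗ[MvPolynomial σ k]
    (Fin (rank i) → MvPolynomial σ k)
  /-- the augmentation, which is `S`-linear for the `S`-module structure on `R` given by `φ` -/
  ε : (Fin (rank 0) → MvPolynomial σ k) →ₛₗ[(φ : MvPolynomial σ k →+* R)] R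
  /-- the augmentation is homogeneous of degree zero -/
  ε_mem : ∀ j, ε (Pi.single j 1) ∈ 𝒜 (deg 0 j)
  /-- the differentials are homogeneous of degree zero: the entry of the matrix of `d i` at `l, j`
  is zero or homogeneous of degree `deg (i + 1) j - deg i l` -/
  d_homogeneous : ∀ i j l, d i (Pi.single j 1) l = 0 ∨
    ∃ n : ℕ, deg i l + n = deg (i + 1) j ∧ (d i (Pi.single j 1) l).IsHomogeneous n
  /-- exactness at `R` -/
  ε_surjective : Function.Surjective ε
  /-- exactness at the free module `F₀` -/
  exact_zero : Function.Exact (d 0) ε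
  /-- exactness at the other free modules -/
  exact_succ : ∀ i, Function.Exact (d (i + 1)) (d i)
  /-- minimality: the image of `d i` lies in `(z_s : s ∈ σ) F i` -/
  minimal : ∀ i j l, constantCoeff (d i (Pi.single j 1) l) = 0

/-- The graded `S`-module `R` has a minimal graded free resolution over the polynomial ring `S`,
and for every such resolution `F` the maximum of `b - i`, over all `i` and all degrees `b` of
generators of `F i`, is `r`. -/
def HasRegularity {k σ R : Type*} [Field k] [Finite σ] [CommRing R]
    [Algebra k R] (φ : MvPolynomial σ k →ₐ[k] R) (𝒜 : ℕ → Submodule k R) (r : ℤ) : Prop :=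
  Nonempty (MinimalGradedFreeResolution φ 𝒜) ∧
    ∀ F : MinimalGradedFreeResolution φ 𝒜,
      IsGreatest {c : ℤ | ∃ (i : ℕ) (j : Fin (F.rank i)), c = (F.deg i j : ℤ) - (i : ℤ)} r

/-! ### Coordinate rings of projective monomial curves -/

namespace MonomialCurve

/-- The coordinate ring `R = k[x ^ α * y ^ (d - α) : α ∈ E]`, a subalgebra of `k[x, y]`, where
`x = X 0` and `y = X 1`. -/
noncomputable def ring (k : Type*) [Field k] (d : ℕ) (E : Finset ℕ) : Subalgebra k (MvPolynomial (Fin 2) k) :=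
  Algebra.adjoin k {f | ∃ α ∈ E, f = X 0 ^ α * X 1 ^ (d - α)}

/-- The generator `x ^ α * y ^ (d - α)` of `R`. -/
noncomputable def gen (k : Type*) [Field k] (d : ℕ) (E : Finset ℕ) (α : E) : ring k d E :=
  ⟨X 0 ^ (α : ℕ) * X 1 ^ (d - (α : ℕ)), Algebra.subset_adjoin ⟨α, α.2, rfl⟩⟩

/-- The component `R_n` of `R`, in the grading for which the generators have degree `1`: the
elements of `R` that are homogeneous of degree `n * d` as polynomials in `x` and `y`. -/
noncomputable def component (k : Type*) [Field k] (d : ℕ) (E : Finset ℕ) (n : ℕ) :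
    Submodule k (ring k d E) :=
  (homogeneousSubmodule (Fin 2) k (n * d)).comap (ring k d E).val.toLinearMap

/-- The ideal `R_+` of `R`, generated by (in fact, the direct sum of) the `R_n` with `n ≥ 1`. -/
noncomputable def irrelevantIdeal (k : Type*) [Field k] (d : ℕ) (E : Finset ℕ) :
    Ideal (ring k d E) :=
  Ideal.span {f | ∃ n : ℕ, 1 ≤ n ∧ f ∈ component k d E n}

/-- The ideal `Q = (x ^ d, y ^ d)` of `R` (for `0, d ∈ E`, so that `x ^ d, y ^ d ∈ R`). -/
noncomputable def Q (k : Type*) [Field k] (d : ℕ) (E : Finset ℕ) : Ideal (ring k d E) :=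
  Ideal.span {f | (f : MvPolynomial (Fin 2) k) = X 0 ^ d ∨ (f : MvPolynomial (Fin 2) k) = X 1 ^ d}

/-- The presentation of `R` as a quotient of the polynomial ring `S = k[z_α : α ∈ E]`, with
`z_α ↦ x ^ α * y ^ (d - α)`. -/
noncomputable def presentation (k : Type*) [Field k] (d : ℕ) (E : Finset ℕ) :
    MvPolynomial E k →ₐ[k] ring k d E :=
  aeval (gen k d E)

end MonomialCurve

/-! Everything rests on a description of the monomials of `R`. A product of `j` generators with
exponents in `[a,d]`, times powers of `y^d`, has an `x`-exponent that can be any integer in `[ja,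
jd]`; so `x^p y^q` lies in `R` exactly when `d ∣ p + q` and `ja ≤ p ≤ jd` for some `j`
(`mem_ring_iff`). Apart from the divisibility, the condition involves `p` only.

Put `r = ⌈(d-1)/(d-a)⌉`, so that `(r-1)(d-a) < d-1 ≤ r(d-a)`. A monomial of degree `n` with `q < d`
has `p ≥ (n-1)d + 1`, and it is divisible by `x^d` in `R` as soon as `p - d ≥ (n-1)a`; the worst
case `p = (n-1)d + 1` asks for `(n-1)(d-a) ≥ d-1`. This holds for `n > r`, while for `n = r` that
worst case survives. Hence `r` is the top degree of `R/Q`, and the reduction number follows by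
comparing monomials.

Cohen–Macaulayness: in each residue class of `p` modulo `d`, all exponents arise from a single one
by adding multiples of `d` to `p` and to `q`. Thus `R` is free of rank `d` over `k[x^d, y^d]`, a
factorial ring of dimension two, and regular sequences can be pulled up along this flat extension
(`isCohenMacaulay_of_finite_of_flat`).

Regularity: reduce a minimal resolution `F` modulo the variables one at a time, starting with the
two that map to `y^d, x^d`. These form a regular sequence on `R`, so after them only `H_0 = R/Q`
matters in the relevant degrees. The long exact sequence for multiplication by each further variable
carries the vanishing of `H_i` in degrees above `r + i`, and moves a nonzero class from `(i, b)` to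
`(i+1, b+1)`. Once all variables are killed the differentials vanish by minimality, and the homology
records the degrees of the generators (`isGreatest_of_regular_pair`). -/

/-! ### Graded free modules over a polynomial ring -/

section GradedFree

variable {k σ : Type*} [Field k]

/-- The homogeneous elements of degree `b` of the free module whose `l`-th generator has degree
`deg l`. -/
noncomputable def gradedPiece {n : ℕ} (deg : Fin n → ℕ) (b : ℕ) : Submodule k (Fin n → MvPolynomial σ k) :=
  Submodule.pi Set.univ fun l ↦
    if deg l ≤ b then homogeneousSubmodule σ k (b - deg l) else ⊥

/-- The projection of a graded free module to its homogeneous elements of degree `b`. -/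
noncomputable def gradedProj {n : ℕ} (deg : Fin n → ℕ) (b : ℕ) :
    (Fin n → MvPolynomial σ k) →ₗ[k] (Fin n → MvPolynomial σ k) :=
  LinearMap.pi fun l ↦
    if deg l ≤ b then homogeneousComponent (b - deg l) ∘ₗ LinearMap.proj l else 0

variable {n m : ℕ} {deg : Fin n → ℕ} {deg' : Fin m → ℕ}

lemma gradedProj_apply (b : ℕ) (v : Fin n → MvPolynomial σ k) (l : Fin n) :
    gradedProj deg b v l = if deg l ≤ b then homogeneousComponent (b - deg l) (v l) else 0 := by
  unfold gradedProj
  split_ifs with h <;> simp [h]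

lemma mem_gradedPiece {b : ℕ} {v : Fin n → MvPolynomial σ k} :
    v ∈ gradedPiece deg b ↔
      ∀ l, v l = 0 ∨ ∃ c : ℕ, deg l + c = b ∧ (v l).IsHomogeneous c := by
  simp only [gradedPiece, Submodule.mem_pi, Set.mem_univ, forall_const]
  refine forall_congr' fun l ↦ ?_
  split_ifs with h
  · rw [mem_homogeneousSubmodule]
    constructor
    · exact fun hl ↦ Or.inr ⟨b - deg l, by omega, hl⟩
    · rintro (hl | ⟨c, hc, hl⟩)
      · rw [hl]; exact isHomogeneous_zero _ _ _
      · rwa [show b - deg l = c by omega]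
  · rw [Submodule.mem_bot]
    constructor
    · exact Or.inl
    · rintro (hl | ⟨c, hc, -⟩)
      · exact hl
      · omega

lemma gradedProj_mem (b : ℕ) (v : Fin n → MvPolynomial σ k) :
    gradedProj deg b v ∈ gradedPiece deg b := by
  rw [mem_gradedPiece]
  intro l
  rw [gradedProj_apply]
  split_ifs with h
  · exact Or.inr ⟨b - deg l, by omega, homogeneousComponent_isHomogeneous _ _⟩
  · exact Or.inl rfl

lemma gradedProj_of_mem {b : ℕ} {v : Fin n → MvPolynomial σ k} (hv : v ∈ gradedPiece deg b) :
    gradedProj deg b v = v := by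
  funext l
  rw [gradedProj_apply]
  rcases mem_gradedPiece.1 hv l with h | ⟨c, hc, h⟩
  · simp [h]
  · rw [if_pos (by omega), show b - deg l = c by omega, homogeneousComponent_eq_self h]

lemma gradedProj_of_mem_of_ne {b b' : ℕ} {v : Fin n → MvPolynomial σ k}
    (hv : v ∈ gradedPiece deg b) (hb : b ≠ b') : gradedProj deg b' v = 0 := by
  funext l
  rw [gradedProj_apply, Pi.zero_apply]
  split_ifs with hl
  · rcases mem_gradedPiece.1 hv l with h | ⟨c, hc, h⟩
    · simp [h]
    · rw [homogeneousComponent_of_mem h, if_neg (by omega)]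
  · rfl

lemma sum_gradedProj (v : Fin n → MvPolynomial σ k) :
    ∃ N, ∑ b ∈ Finset.range N, gradedProj deg b v = v := by
  obtain ⟨D, hD⟩ : ∃ D, ∀ l, deg l ≤ D :=
    ⟨Finset.univ.sup deg, fun l ↦ Finset.le_sup (Finset.mem_univ l)⟩
  obtain ⟨M, hM⟩ : ∃ M, ∀ l, (v l).totalDegree ≤ M :=
    ⟨Finset.univ.sup fun l ↦ (v l).totalDegree,
      fun l ↦ Finset.le_sup (f := fun l ↦ (v l).totalDegree) (Finset.mem_univ l)⟩
  -- In coordinate `l` the projection to degree `b` vanishes unless `deg l ≤ b ≤ deg l +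
  -- totalDegree`, and `D + M` bounds the right-hand side.
  refine ⟨D + M + 1, funext fun l ↦ ?_⟩
  have h1 : deg l ≤ D + M + 1 := by have := hD l; omega
  rw [Finset.sum_apply, ← Finset.sum_range_add_sum_Ico _ h1,
    Finset.sum_eq_zero, zero_add, Finset.sum_Ico_eq_sum_range]
  · have h2 : (v l).totalDegree + 1 ≤ D + M + 1 - deg l := by
      have := hD l; have := hM l; omega
    rw [← Finset.sum_range_add_sum_Ico _ h2]
    conv_rhs => rw [← sum_homogeneousComponent (v l), ← add_zero (∑ i ∈ _, _)]
    congr 1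
    · refine Finset.sum_congr rfl fun i _ ↦ ?_
      rw [gradedProj_apply, if_pos (by omega), Nat.add_sub_cancel_left]
    · refine Finset.sum_eq_zero fun i hi ↦ ?_
      rw [gradedProj_apply, if_pos (by omega), Nat.add_sub_cancel_left,
        homogeneousComponent_eq_zero]
      have := (Finset.mem_Ico.1 hi).1
      omega
  · intro b hb
    rw [gradedProj_apply, if_neg (by have := Finset.mem_range.1 hb; omega)]

lemma smul_mem_gradedPiece {b c e : ℕ} {v : Fin n → MvPolynomial σ k} {p : MvPolynomial σ k}
    (hv : v ∈ gradedPiece deg b) (hp : p.IsHomogeneous c) (he : b + c = e) :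
    p • v ∈ gradedPiece deg e := by
  rw [mem_gradedPiece]
  intro l
  rcases mem_gradedPiece.1 hv l with h | ⟨a, ha, h⟩
  · exact Or.inl (by simp [h])
  · exact Or.inr ⟨c + a, by omega, by simpa using hp.mul h⟩

lemma single_one_mem_gradedPiece (j : Fin n) :
    (Pi.single j 1 : Fin n → MvPolynomial σ k) ∈ gradedPiece deg (deg j) := by
  rw [mem_gradedPiece]
  intro l
  rcases eq_or_ne l j with rfl | h
  · exact Or.inr ⟨0, rfl, by simpa using isHomogeneous_one σ k⟩
  · exact Or.inl (by simp [h])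

lemma eq_sum_smul_single {A : Type*} [CommRing A] (v : Fin n → A) :
    v = ∑ j, v j • (Pi.single j 1 : Fin n → A) := by
  funext l
  simp [Finset.sum_apply, Pi.single_apply]

lemma map_mem_gradedPiece
    {D : (Fin m → MvPolynomial σ k) →ₗ[MvPolynomial σ k] (Fin n → MvPolynomial σ k)}
    (hD : ∀ j, D (Pi.single j 1) ∈ gradedPiece deg (deg' j)) {b : ℕ}
    {v : Fin m → MvPolynomial σ k} (hv : v ∈ gradedPiece deg' b) : D v ∈ gradedPiece deg b := by
  rw [eq_sum_smul_single v, map_sum]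
  refine Submodule.sum_mem _ fun j _ ↦ ?_
  rw [map_smul]
  rcases mem_gradedPiece.1 hv j with h | ⟨c, hc, h⟩
  · rw [h, zero_smul]; exact Submodule.zero_mem _
  · exact smul_mem_gradedPiece (hD j) h hc

/-- A map that respects the degrees commutes with the projections. -/
lemma gradedProj_map
    {D : (Fin m → MvPolynomial σ k) →ₗ[MvPolynomial σ k] (Fin n → MvPolynomial σ k)}
    (hD : ∀ j, D (Pi.single j 1) ∈ gradedPiece deg (deg' j)) (b : ℕ)
    (v : Fin m → MvPolynomial σ k) :
    gradedProj deg b (D v) = D (gradedProj deg' b v) := by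
  obtain ⟨N, hN⟩ := sum_gradedProj (deg := deg') v
  have key : ∀ w ∈ Set.range fun c ↦ gradedProj deg' c v,
      gradedProj deg b (D w) = D (gradedProj deg' b w) := by
    rintro _ ⟨c, rfl⟩
    have h1 := gradedProj_mem (deg := deg') c v
    have h2 := map_mem_gradedPiece hD h1
    rcases eq_or_ne c b with rfl | h
    · rw [gradedProj_of_mem h2, gradedProj_of_mem h1]
    · rw [gradedProj_of_mem_of_ne h2 h, gradedProj_of_mem_of_ne h1 h, map_zero]
  rw [← hN]
  simp only [map_sum]
  exact Finset.sum_congr rfl fun c _ ↦ key _ ⟨c, rfl⟩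

/-! ### Vectors with entries in an ideal generated by variables -/

/-- The submodule of vectors whose entries lie in the ideal generated by the variables in `T`. -/
noncomputable def varVectors (k : Type*) {σ : Type*} [Field k] (T : Set σ) (n : ℕ) :
    Submodule (MvPolynomial σ k) (Fin n → MvPolynomial σ k) :=
  Submodule.pi Set.univ fun _ ↦ (Ideal.span (X '' T) : Ideal (MvPolynomial σ k))

variable {T : Set σ}

lemma mem_varVectors {v : Fin n → MvPolynomial σ k} :
    v ∈ varVectors k T n ↔ ∀ l, v l ∈ Ideal.span (X '' T : Set (MvPolynomial σ k)) := by
  simp [varVectors, Submodule.mem_pi]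

lemma varVectors_mono {T' : Set σ} (h : T ⊆ T') : varVectors k T n ≤ varVectors k T' n :=
  fun _ hv ↦ mem_varVectors.2 fun l ↦
    Ideal.span_mono (Set.image_mono h) (mem_varVectors.1 hv l)

lemma X_smul_mem_varVectors {t : σ} (ht : t ∈ T) (v : Fin n → MvPolynomial σ k) :
    (X t : MvPolynomial σ k) • v ∈ varVectors k T n :=
  mem_varVectors.2 fun _ ↦
    Ideal.mul_mem_right _ _ (Ideal.subset_span (Set.mem_image_of_mem _ ht))

lemma map_mem_varVectors
    (D : (Fin m → MvPolynomial σ k) →ₗ[MvPolynomial σ k] (Fin n → MvPolynomial σ k))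
    {v : Fin m → MvPolynomial σ k} (hv : v ∈ varVectors k T m) : D v ∈ varVectors k T n := by
  rw [eq_sum_smul_single v, map_sum]
  refine Submodule.sum_mem _ fun j _ ↦ ?_
  rw [map_smul]
  exact mem_varVectors.2 fun l ↦ Ideal.mul_mem_right _ _ (mem_varVectors.1 hv j)

/-- Membership in a monomial ideal is tested on the support, and passing to a homogeneous component
only shrinks the support. -/
lemma homogeneousComponent_mem_span_X {p : MvPolynomial σ k} (c : ℕ)
    (hp : p ∈ Ideal.span (X '' T : Set (MvPolynomial σ k))) :
    homogeneousComponent c p ∈ Ideal.span (X '' T : Set (MvPolynomial σ k)) := by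
  classical
  rw [mem_ideal_span_X_image] at hp ⊢
  intro m hm
  refine hp m ?_
  rw [mem_support_iff, coeff_homogeneousComponent] at hm
  rw [mem_support_iff]
  intro h
  simp [h] at hm

lemma gradedProj_mem_varVectors {v : Fin n → MvPolynomial σ k} (b : ℕ)
    (hv : v ∈ varVectors k T n) : gradedProj deg b v ∈ varVectors k T n := by
  rw [mem_varVectors] at hv ⊢
  intro l
  rw [gradedProj_apply]
  split_ifs
  · exact homogeneousComponent_mem_span_X _ (hv l)
  · exact Ideal.zero_mem _

/-- A variable outside of `T` is a nonzerodivisor modulo the variables in `T`. -/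
lemma mem_varVectors_of_X_smul {t : σ} (ht : t ∉ T) {v : Fin n → MvPolynomial σ k}
    (hv : (X t : MvPolynomial σ k) • v ∈ varVectors k T n) : v ∈ varVectors k T n := by
  classical
  rw [mem_varVectors] at hv ⊢
  intro l
  have hl := hv l
  rw [Pi.smul_apply, smul_eq_mul, mem_ideal_span_X_image] at hl
  rw [mem_ideal_span_X_image]
  intro e he
  obtain ⟨i, hi, h⟩ := hl (Finsupp.single t 1 + e) (by
    rw [mem_support_iff, coeff_X_mul]
    exact mem_support_iff.1 he)
  refine ⟨i, hi, ?_⟩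
  have : i ≠ t := fun h ↦ ht (h ▸ hi)
  simpa [Finsupp.single_apply, this.symm] using h

lemma exists_sub_X_smul_mem_varVectors {t : σ} {v : Fin n → MvPolynomial σ k}
    (hv : v ∈ varVectors k (insert t T) n) :
    ∃ w : Fin n → MvPolynomial σ k, v - (X t : MvPolynomial σ k) • w ∈ varVectors k T n := by
  have h : ∀ l, ∃ w, v l - X t * w ∈ Ideal.span (X '' T : Set (MvPolynomial σ k)) := by
    intro l
    have := mem_varVectors.1 hv l
    rw [Set.image_insert_eq, Ideal.mem_span_insert] at this
    obtain ⟨w, z, hz, h⟩ := this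
    exact ⟨w, by rwa [h, mul_comm, add_sub_cancel_left]⟩
  choose w hw using h
  exact ⟨w, mem_varVectors.2 hw⟩

lemma gradedProj_X_smul (t : σ) (b : ℕ) (v : Fin n → MvPolynomial σ k) :
    gradedProj deg (b + 1) ((X t : MvPolynomial σ k) • v) =
      (X t : MvPolynomial σ k) • gradedProj deg b v := by
  obtain ⟨N, hN⟩ := sum_gradedProj (deg := deg) v
  have key : ∀ w ∈ Set.range fun c ↦ gradedProj deg c v,
      gradedProj deg (b + 1) ((X t : MvPolynomial σ k) • w) =
        (X t : MvPolynomial σ k) • gradedProj deg b w := by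
    rintro _ ⟨c, rfl⟩
    have h1 := gradedProj_mem (deg := deg) c v
    have h2 := smul_mem_gradedPiece h1 (isHomogeneous_X k t) rfl
    rcases eq_or_ne c b with rfl | h
    · rw [gradedProj_of_mem h2, gradedProj_of_mem h1]
    · rw [gradedProj_of_mem_of_ne h2 (by omega), gradedProj_of_mem_of_ne h1 h, smul_zero]
  rw [← hN]
  simp only [map_sum, Finset.smul_sum]
  exact Finset.sum_congr rfl fun c _ ↦ key _ ⟨c, rfl⟩

lemma exists_mem_gradedPiece_sub_X_smul_mem {t : σ} {b : ℕ} {v : Fin n → MvPolynomial σ k}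
    (hb : v ∈ gradedPiece deg (b + 1)) (hv : v ∈ varVectors k (insert t T) n) :
    ∃ w ∈ gradedPiece deg b, v - (X t : MvPolynomial σ k) • w ∈ varVectors k T n := by
  obtain ⟨w, hw⟩ := exists_sub_X_smul_mem_varVectors hv
  refine ⟨gradedProj deg b w, gradedProj_mem _ _, ?_⟩
  have := gradedProj_mem_varVectors (deg := deg) (b + 1) hw
  rwa [map_sub, gradedProj_X_smul, gradedProj_of_mem hb] at this

lemma varVectors_empty : varVectors k (∅ : Set σ) n = ⊥ := by
  ext v
  rw [mem_varVectors]
  simp [funext_iff]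

lemma mem_varVectors_univ {v : Fin n → MvPolynomial σ k} :
    v ∈ varVectors k (Set.univ : Set σ) n ↔ ∀ l, constantCoeff (v l) = 0 := by
  rw [mem_varVectors]
  refine forall_congr' fun l ↦ ?_
  rw [mem_ideal_span_X_image, constantCoeff_eq]
  constructor
  · intro h
    by_contra h0
    obtain ⟨i, -, hi⟩ := h 0 (mem_support_iff.2 h0)
    exact hi rfl
  · intro h m hm
    have : m ≠ 0 := by
      rintro rfl
      exact mem_support_iff.1 hm h
    obtain ⟨i, hi⟩ := Finsupp.ne_iff.1 this
    exact ⟨i, Set.mem_univ _, hi⟩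

end GradedFree

/-! ### The Koszul-type induction for the regularity -/

namespace MinimalGradedFreeResolution

variable {k σ R : Type*} [Field k] [Finite σ] [CommRing R] [Algebra k R]
  {φ : MvPolynomial σ k →ₐ[k] R} {𝒜 : ℕ → Submodule k R}

/-- The vector `c` of the `i`-th free module is a cycle modulo the variables in `T`. -/
def IsCycleMod (F : MinimalGradedFreeResolution φ 𝒜) (T : Set σ) :
    (i : ℕ) → (Fin (F.rank i) → MvPolynomial σ k) → Prop
  | 0, _ => True
  | i + 1, c => F.d i c ∈ varVectors k T (F.rank i)

/-- The vector `c` of the `i`-th free module is a boundary modulo the variables in `T`. -/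
def IsBoundaryMod (F : MinimalGradedFreeResolution φ 𝒜) (T : Set σ) (i : ℕ)
    (c : Fin (F.rank i) → MvPolynomial σ k) : Prop :=
  ∃ c', c - F.d i c' ∈ varVectors k T (F.rank i)

/-- The `i`-th homology of the resolution modulo the variables in `T` vanishes in degree `b`. -/
def HomologyVanishes (F : MinimalGradedFreeResolution φ 𝒜) (T : Set σ) (i b : ℕ) : Prop :=
  ∀ c ∈ gradedPiece (F.deg i) b, F.IsCycleMod T i c → F.IsBoundaryMod T i c

variable {F : MinimalGradedFreeResolution φ 𝒜} {T : Set σ} {t : σ} {i b : ℕ}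

lemma d_single_mem (F : MinimalGradedFreeResolution φ 𝒜) (i : ℕ) (j : Fin (F.rank (i + 1))) :
    F.d i (Pi.single j 1) ∈ gradedPiece (F.deg i) (F.deg (i + 1) j) :=
  mem_gradedPiece.2 fun l ↦ F.d_homogeneous i j l

lemma d_mem_gradedPiece {c : Fin (F.rank (i + 1)) → MvPolynomial σ k}
    (hc : c ∈ gradedPiece (F.deg (i + 1)) b) : F.d i c ∈ gradedPiece (F.deg i) b :=
  map_mem_gradedPiece (F.d_single_mem i) hc

lemma IsBoundaryMod.exists_mem_gradedPiece {c : Fin (F.rank i) → MvPolynomial σ k}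
    (h : F.IsBoundaryMod T i c) (hc : c ∈ gradedPiece (F.deg i) b) :
    ∃ c' ∈ gradedPiece (F.deg (i + 1)) b, c - F.d i c' ∈ varVectors k T (F.rank i) := by
  obtain ⟨c', h⟩ := h
  refine ⟨gradedProj (F.deg (i + 1)) b c', gradedProj_mem _ _, ?_⟩
  have := gradedProj_mem_varVectors (deg := F.deg i) b h
  rwa [map_sub, gradedProj_of_mem hc, gradedProj_map (F.d_single_mem i)] at this

/-- A cycle modulo `T ∪ {t}` of positive homological degree has a connecting cycle modulo `T`. -/
lemma IsCycleMod.exists_connecting (ht : t ∉ T)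
    {c : Fin (F.rank (i + 1)) → MvPolynomial σ k} (hc : c ∈ gradedPiece (F.deg (i + 1)) (b + 1))
    (h : F.IsCycleMod (insert t T) (i + 1) c) :
    ∃ w ∈ gradedPiece (F.deg i) b,
      F.d i c - (X t : MvPolynomial σ k) • w ∈ varVectors k T (F.rank i) ∧ F.IsCycleMod T i w := by
  obtain ⟨w, hw, h⟩ := exists_mem_gradedPiece_sub_X_smul_mem (d_mem_gradedPiece hc) h
  refine ⟨w, hw, h, ?_⟩
  cases i with
  | zero => trivial
  | succ i =>
    -- Applying the next differential to `d c ≡ X_t w` gives `X_t d w ≡ 0` modulo `T`, and `X_t` can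
    -- be cancelled.
    refine mem_varVectors_of_X_smul ht ?_
    have h1 := map_mem_varVectors (F.d i) h
    rw [map_sub, map_smul, (F.exact_succ i).apply_apply_eq_zero, zero_sub] at h1
    exact (Submodule.neg_mem_iff _).1 h1

/-- If the connecting cycle is a boundary, then so is the given cycle. -/
lemma isBoundaryMod_of_connecting (hv : F.HomologyVanishes T (i + 1) (b + 1))
    {c : Fin (F.rank (i + 1)) → MvPolynomial σ k} (hc : c ∈ gradedPiece (F.deg (i + 1)) (b + 1))
    {w : Fin (F.rank i) → MvPolynomial σ k} (hw : w ∈ gradedPiece (F.deg i) b)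
    (h : F.d i c - (X t : MvPolynomial σ k) • w ∈ varVectors k T (F.rank i))
    (hb : F.IsBoundaryMod T i w) : F.IsBoundaryMod (insert t T) (i + 1) c := by
  obtain ⟨w', hw', hb⟩ := hb.exists_mem_gradedPiece hw
  -- With `w ≡ d w'` modulo `T`, the correction `c - X_t w'` is a cycle already modulo `T`.
  obtain ⟨c', hc'⟩ := hv (c - (X t : MvPolynomial σ k) • w')
    (Submodule.sub_mem _ hc (smul_mem_gradedPiece hw' (isHomogeneous_X k t) rfl)) (by
      have : F.d i (c - (X t : MvPolynomial σ k) • w') =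
          (F.d i c - (X t : MvPolynomial σ k) • w) +
            (X t : MvPolynomial σ k) • (w - F.d i w') := by
        rw [map_sub, map_smul, smul_sub]; abel
      rw [IsCycleMod, this]
      exact Submodule.add_mem _ h (Submodule.smul_mem _ _ hb))
  refine ⟨c', ?_⟩
  have : c - F.d (i + 1) c' = (c - (X t : MvPolynomial σ k) • w' - F.d (i + 1) c') +
      (X t : MvPolynomial σ k) • w' := by abel
  rw [this]
  exact Submodule.add_mem _ (varVectors_mono (Set.subset_insert _ _) hc')
    (X_smul_mem_varVectors (Set.mem_insert _ _) _)

lemma HomologyVanishes.insert_zero (h : F.HomologyVanishes T 0 b) :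
    F.HomologyVanishes (insert t T) 0 b := fun c hc _ ↦
  (h c hc trivial).imp fun _ ↦ (varVectors_mono (Set.subset_insert _ _) ·)

/-- In the long exact sequence of multiplication by `X_t`, the group `H_{i+1}(T ∪ {t})` in degree
`b+1` sits between `H_{i+1}(T)` in degree `b+1` and `H_i(T)` in degree `b`. -/
lemma HomologyVanishes.insert_succ (ht : t ∉ T) (h : F.HomologyVanishes T i b)
    (h' : F.HomologyVanishes T (i + 1) (b + 1)) :
    F.HomologyVanishes (insert t T) (i + 1) (b + 1) := fun c hc hcyc ↦ by
  obtain ⟨w, hw, h1, h2⟩ := hcyc.exists_connecting ht hc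
  exact isBoundaryMod_of_connecting h' hc hw h1 (h w hw h2)

/-- Multiplication by `X_t` sends `H_i(T)` in degree `b` to `H_i(T)` in degree `b+1`, which is zero;
so the connecting map from `H_{i+1}(T ∪ {t})` onto `H_i(T)` is surjective, and its source cannot
vanish. -/
lemma not_homologyVanishes_insert (ht : t ∉ T) (h : ¬ F.HomologyVanishes T i b)
    (h' : F.HomologyVanishes T i (b + 1)) :
    ¬ F.HomologyVanishes (insert t T) (i + 1) (b + 1) := by
  intro hv
  refine h fun w hw hcyc ↦ ?_
  obtain ⟨c, hc, hwc⟩ := (h' ((X t : MvPolynomial σ k) • w)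
    (smul_mem_gradedPiece hw (isHomogeneous_X k t) rfl) (by
      cases i with
      | zero => trivial
      | succ i =>
        rw [IsCycleMod, map_smul]
        exact Submodule.smul_mem _ _ hcyc)).exists_mem_gradedPiece
    (smul_mem_gradedPiece hw (isHomogeneous_X k t) rfl)
  obtain ⟨e, he⟩ := hv c hc (by
    rw [IsCycleMod, show F.d i c = (X t : MvPolynomial σ k) • w -
      ((X t : MvPolynomial σ k) • w - F.d i c) by abel]
    exact Submodule.sub_mem _ (X_smul_mem_varVectors (Set.mem_insert _ _) _)
      (varVectors_mono (Set.subset_insert _ _) hwc))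
  obtain ⟨v, hv⟩ := exists_sub_X_smul_mem_varVectors he
  refine ⟨v, mem_varVectors_of_X_smul ht ?_⟩
  have h1 := map_mem_varVectors (F.d i) hv
  rw [map_sub, map_sub, (F.exact_succ i).apply_apply_eq_zero, sub_zero, map_smul] at h1
  rw [smul_sub, show (X t : MvPolynomial σ k) • w - (X t : MvPolynomial σ k) • F.d i v =
    ((X t : MvPolynomial σ k) • w - F.d i c) + (F.d i c - (X t : MvPolynomial σ k) • F.d i v) by
      abel]
  exact Submodule.add_mem _ hwc h1

/-! ### The zeroth homology -/

lemma ε_mem_map {c : Fin (F.rank 0) → MvPolynomial σ k} (hc : c ∈ varVectors k T (F.rank 0)) :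
    F.ε c ∈ Ideal.span ((fun s ↦ φ (X s)) '' T) := by
  rw [eq_sum_smul_single c, map_sum]
  refine Submodule.sum_mem _ fun j _ ↦ ?_
  rw [map_smulₛₗ]
  refine Ideal.mul_mem_right _ _ ?_
  have h := Ideal.mem_map_of_mem (φ : MvPolynomial σ k →+* R) (mem_varVectors.1 hc j)
  rw [Ideal.map_span, ← Set.image_comp] at h
  exact h

lemma exists_ε_eq {x : R} (hx : x ∈ Ideal.span ((fun s ↦ φ (X s)) '' T)) :
    ∃ c ∈ varVectors k T (F.rank 0), F.ε c = x := by
  -- The extra multiplier `r` lets the induction absorb scalars from `R`, for which `ε` is not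
  -- linear.
  have key : ∀ r : R, ∃ c ∈ varVectors k T (F.rank 0), F.ε c = r * x := by
    induction hx using Submodule.span_induction with
    | mem x hx =>
      intro r
      obtain ⟨s, hs, rfl⟩ := hx
      obtain ⟨v, rfl⟩ := F.ε_surjective r
      exact ⟨(X s : MvPolynomial σ k) • v, X_smul_mem_varVectors hs v, by
        rw [map_smulₛₗ, smul_eq_mul, mul_comm]; rfl⟩
    | zero => exact fun r ↦ ⟨0, Submodule.zero_mem _, by simp⟩
    | add x y _ _ hx hy =>
      intro r
      obtain ⟨c, hc, h⟩ := hx r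
      obtain ⟨c', hc', h'⟩ := hy r
      exact ⟨c + c', Submodule.add_mem _ hc hc', by rw [map_add, h, h', mul_add]⟩
    | smul a x _ hx =>
      intro r
      obtain ⟨c, hc, h⟩ := hx (r * a)
      exact ⟨c, hc, by rw [h, smul_eq_mul, mul_assoc]⟩
  simpa using key 1

/-- The augmentation identifies the zeroth homology modulo `T` with the quotient of `R` by the
images of the variables in `T`. -/
lemma isBoundaryMod_zero_iff {c : Fin (F.rank 0) → MvPolynomial σ k} :
    F.IsBoundaryMod T 0 c ↔ F.ε c ∈ Ideal.span ((fun s ↦ φ (X s)) '' T) := by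
  constructor
  · rintro ⟨c', h⟩
    have := F.ε_mem_map h
    rwa [map_sub, F.exact_zero.apply_apply_eq_zero, sub_zero] at this
  · intro h
    obtain ⟨c', hc', h⟩ := F.exists_ε_eq h
    obtain ⟨e, he⟩ := (F.exact_zero (c - c')).1 (by rw [map_sub, h, sub_self])
    exact ⟨e, by rwa [he, sub_sub_cancel]⟩

lemma homologyVanishes_empty : F.HomologyVanishes ∅ (i + 1) b := fun c _ h ↦ by
  rw [IsCycleMod, varVectors_empty, Submodule.mem_bot] at h
  obtain ⟨c', rfl⟩ := (F.exact_succ i c).1 h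
  exact ⟨c', by rw [sub_self]; exact Submodule.zero_mem _⟩

/-- Killing a variable that is a nonzerodivisor on `R` modulo the variables in `T` keeps the
higher homology zero. -/
lemma homologyVanishes_insert_of_regular (ht : t ∉ T)
    (hv : ∀ i b, i + 1 < b → F.HomologyVanishes T (i + 1) b)
    (hreg : ∀ x, φ (X t) * x ∈ Ideal.span ((fun s ↦ φ (X s)) '' T) →
      x ∈ Ideal.span ((fun s ↦ φ (X s)) '' T)) :
    ∀ i b, i + 1 < b → F.HomologyVanishes (insert t T) (i + 1) b := by
  intro i b hb
  -- The bound `i + 1 < b` guarantees that `b` is a successor, and it is preserved when both indices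
  -- drop by one.
  obtain ⟨b, rfl⟩ : ∃ b', b = b' + 1 := ⟨b - 1, by omega⟩
  cases i with
  | zero =>
    intro c hc hcyc
    obtain ⟨w, hw, h1, -⟩ := hcyc.exists_connecting ht hc
    refine isBoundaryMod_of_connecting (hv 0 (b + 1) hb) hc hw h1 ?_
    have h2 := F.ε_mem_map h1
    rw [map_sub, F.exact_zero.apply_apply_eq_zero, zero_sub, neg_mem_iff, map_smulₛₗ] at h2
    exact isBoundaryMod_zero_iff.2 (hreg _ h2)
  | succ i => exact (hv i b (by omega)).insert_succ ht (hv (i + 1) (b + 1) hb)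

lemma ε_mem_of_mem_gradedPiece (F : MinimalGradedFreeResolution φ 𝒜)
    (hφ : ∀ n p, p.IsHomogeneous n → φ p ∈ 𝒜 n)
    (hmul : ∀ i j x y, x ∈ 𝒜 i → y ∈ 𝒜 j → x * y ∈ 𝒜 (i + j))
    {c : Fin (F.rank 0) → MvPolynomial σ k} (hc : c ∈ gradedPiece (F.deg 0) b) :
    F.ε c ∈ 𝒜 b := by
  rw [eq_sum_smul_single c, map_sum]
  refine Submodule.sum_mem _ fun j _ ↦ ?_
  rw [map_smulₛₗ]
  rcases mem_gradedPiece.1 hc j with h | ⟨n, rfl, h⟩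
  · rw [h, map_zero, zero_smul]; exact Submodule.zero_mem _
  · rw [add_comm]
    exact hmul _ _ _ _ (hφ n _ h) (F.ε_mem j)

/-! ### The regularity of a quotient with two parameters -/

/-- If two variables form a regular sequence on `R`, and `r` is the top degree of the quotient of
`R` by these variables, then `r` is the maximum of the `b - i`, where `b` is the degree of a
generator of the `i`-th module of a minimal graded free resolution. -/
theorem isGreatest_of_regular_pair (F : MinimalGradedFreeResolution φ 𝒜)
    (hφ : ∀ n p, p.IsHomogeneous n → φ p ∈ 𝒜 n)
    (hmul : ∀ i j x y, x ∈ 𝒜 i → y ∈ 𝒜 j → x * y ∈ 𝒜 (i + j))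
    {s t : σ} (hst : s ≠ t) (hs : ∀ x, φ (X s) * x = 0 → x = 0)
    (ht : ∀ x, φ (X t) * x ∈ Ideal.span {φ (X s)} → x ∈ Ideal.span {φ (X s)}) {r : ℕ}
    (hup : ∀ b x, r < b → x ∈ 𝒜 b → x ∈ Ideal.span {φ (X s), φ (X t)})
    (hlow : ∃ x ∈ 𝒜 r, x ∉ Ideal.span {φ (X s), φ (X t)})
    (hproj : ∃ π : R →+ R, (∀ x ∈ 𝒜 r, π x = x) ∧ ∀ b, b ≠ r → ∀ x ∈ 𝒜 b, π x = 0) :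
    IsGreatest {c : ℤ | ∃ (i : ℕ) (j : Fin (F.rank i)), c = (F.deg i j : ℤ) - (i : ℤ)} r := by
  classical
  have hv0 : ∀ i b, i + 1 < b → F.HomologyVanishes {t, s} (i + 1) b := by
    refine homologyVanishes_insert_of_regular (by simpa using hst.symm) ?_ (by simpa using ht)
    rw [← insert_empty_eq s]
    refine homologyVanishes_insert_of_regular (Set.notMem_empty _)
      (fun _ _ _ ↦ homologyVanishes_empty) ?_
    simpa using hs
  have hspan : Ideal.span ((fun s ↦ φ (X s)) '' {t, s}) = Ideal.span {φ (X s), φ (X t)} := by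
    rw [Set.image_pair, Set.pair_comm]
  have hv1 : ∀ i b, r + i < b → F.HomologyVanishes {t, s} i b := by
    intro i b hb
    cases i with
    | zero =>
      intro c hc _
      rw [isBoundaryMod_zero_iff, hspan]
      exact hup b _ hb (F.ε_mem_of_mem_gradedPiece hφ hmul hc)
    | succ i => exact hv0 i b (by omega)
  have hv2 : ¬ F.HomologyVanishes {t, s} 0 r := by
    intro h
    obtain ⟨x, hx, hx'⟩ := hlow
    obtain ⟨π, hπ, hπ'⟩ := hproj
    obtain ⟨c, rfl⟩ := F.ε_surjective x
    -- The family `𝒜` is not assumed to be a direct decomposition; the projection `π` makes it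
    -- possible to replace `c` by its part of degree `r`.
    have hcr : F.ε c = F.ε (gradedProj (F.deg 0) r c) := by
      obtain ⟨N, hN⟩ := sum_gradedProj (deg := F.deg 0) c
      have hmem : ∀ b, F.ε (gradedProj (F.deg 0) b c) ∈ 𝒜 b := fun b ↦
        F.ε_mem_of_mem_gradedPiece hφ hmul (gradedProj_mem b c)
      have key : F.ε c = if r < N then F.ε (gradedProj (F.deg 0) r c) else 0 := by
        conv_lhs => rw [← hπ _ hx, ← hN, map_sum, map_sum]
        simp only [← Finset.mem_range]
        rw [← Finset.sum_ite_eq' (Finset.range N) r fun b ↦ F.ε (gradedProj (F.deg 0) b c)]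
        refine Finset.sum_congr rfl fun b _ ↦ ?_
        split_ifs with hb
        · subst hb; exact hπ _ (hmem _)
        · exact hπ' _ hb _ (hmem _)
      split_ifs at key with hr
      · exact key
      · exact absurd (key ▸ Submodule.zero_mem _) hx'
    have := isBoundaryMod_zero_iff.1 (h _ (gradedProj_mem r c) trivial)
    rw [hspan, ← hcr] at this
    exact hx' this
  -- Each further variable raises the homological index and the degree of the surviving class by
  -- one, so the difference stays `r`.
  have hind : ∀ U : Finset σ, Disjoint (U : Set σ) {t, s} →
      (∀ i b, r + i < b → F.HomologyVanishes ((U : Set σ) ∪ {t, s}) i b) ∧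
        ¬ F.HomologyVanishes ((U : Set σ) ∪ {t, s}) U.card (r + U.card) := by
    intro U
    induction U using Finset.induction_on with
    | empty => intro _; simpa using ⟨hv1, hv2⟩
    | insert u U hu ih =>
      intro hd
      rw [Finset.coe_insert, Set.disjoint_insert_left] at hd
      obtain ⟨h1, h2⟩ := ih hd.2
      have hu' : u ∉ (U : Set σ) ∪ {t, s} := by
        rintro (h | h)
        · exact hu h
        · exact hd.1 h
      rw [Finset.coe_insert, Set.insert_union, Finset.card_insert_of_notMem hu]
      refine ⟨fun i b hb ↦ ?_, ?_⟩
      · cases i with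
        | zero => exact (h1 0 b hb).insert_zero
        | succ i =>
          obtain ⟨b, rfl⟩ : ∃ b', b = b' + 1 := ⟨b - 1, by omega⟩
          exact (h1 i b (by omega)).insert_succ hu' (h1 (i + 1) (b + 1) hb)
      · exact not_homologyVanishes_insert hu' h2 (h1 _ _ (Nat.lt_succ_self _))
  have := Fintype.ofFinite σ
  obtain ⟨h1, h2⟩ := hind (Finset.univ \ {t, s}) (by
    rw [Finset.coe_sdiff, Finset.coe_pair, Set.pair_comm]; exact Set.disjoint_sdiff_left)
  rw [show ((Finset.univ \ {t, s} : Finset σ) : Set σ) ∪ {t, s} = Set.univ by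
    rw [Finset.coe_sdiff, Finset.coe_univ, Finset.coe_pair, Set.pair_comm]
    exact Set.sdiff_union_of_subset (Set.subset_univ _)] at h1 h2
  have hd : ∀ i c, F.d i c ∈ varVectors k Set.univ (F.rank i) := by
    intro i c
    rw [eq_sum_smul_single c, map_sum]
    refine Submodule.sum_mem _ fun j _ ↦ ?_
    rw [map_smul]
    exact Submodule.smul_mem _ _ (mem_varVectors_univ.2 fun l ↦ F.minimal i j l)
  have hcyc : ∀ i c, F.IsCycleMod Set.univ i c := by
    intro i c
    cases i with
    | zero => trivial
    | succ i => exact hd i c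
  -- By minimality the differentials vanish modulo all variables, so the homology is `F i` modulo
  -- the variables.
  have hbd : ∀ i c, F.IsBoundaryMod Set.univ i c ↔ ∀ l, constantCoeff (c l) = 0 := by
    intro i c
    rw [← mem_varVectors_univ]
    constructor
    · rintro ⟨c', h⟩
      simpa using Submodule.add_mem _ h (hd i c')
    · intro h
      exact ⟨0, by simpa using h⟩
  constructor
  · rw [HomologyVanishes] at h2
    push Not at h2
    obtain ⟨c, hc, -, h⟩ := h2
    rw [hbd] at h
    push Not at h
    obtain ⟨l, hl⟩ := h
    refine ⟨_, l, ?_⟩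
    rcases mem_gradedPiece.1 hc l with h0 | ⟨n, hn, h0⟩
    · exact absurd (by rw [h0, map_zero]) hl
    -- A homogeneous entry with nonzero constant term has degree zero, so the generator `l` has
    -- degree exactly `r` plus the homological index.
    · have : n = 0 := by
        by_contra hne
        exact hl (h0.coeff_eq_zero (by simpa using Ne.symm hne))
      omega
  · rintro _ ⟨i, j, rfl⟩
    by_contra hlt
    have := (hbd i _).1 (h1 i (F.deg i j) (by omega) _ (single_one_mem_gradedPiece j)
      (hcyc i _)) j
    simp at this

end MinimalGradedFreeResolution

/-! ### Existence of minimal graded free resolutions -/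

section Existence

variable {k σ : Type*} [Field k]

/-- A graded submodule is generated by finitely many homogeneous elements. -/
lemma exists_homogeneous_generators [Finite σ] {n : ℕ} (deg : Fin n → ℕ)
    (K : Submodule (MvPolynomial σ k) (Fin n → MvPolynomial σ k))
    (hK : ∀ b, ∀ v ∈ K, gradedProj deg b v ∈ K) :
    ∃ (m : ℕ) (g : Fin m → Fin n → MvPolynomial σ k),
      (∀ j, ∃ b, g j ∈ gradedPiece deg b) ∧ Submodule.span _ (Set.range g) = K := by
  have hspan : Submodule.span (MvPolynomial σ k)
      {v | v ∈ K ∧ ∃ b, v ∈ gradedPiece deg b} = K := by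
    refine le_antisymm (Submodule.span_le.2 fun v hv ↦ hv.1) fun v hv ↦ ?_
    obtain ⟨N, hN⟩ := sum_gradedProj (deg := deg) v
    rw [← hN]
    exact Submodule.sum_mem _ fun b _ ↦
      Submodule.subset_span ⟨hK b v hv, b, gradedProj_mem b v⟩
  have hfg : K.FG := IsNoetherian.noetherian K
  rw [← hspan, Submodule.fg_span_iff_fg_span_finset_subset] at hfg
  obtain ⟨G, hG, hGs⟩ := hfg
  refine ⟨G.card, fun j ↦ (G.equivFin.symm j : Fin n → MvPolynomial σ k),
    fun j ↦ (hG (G.equivFin.symm j).2).2, ?_⟩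
  rw [← hspan, hGs]
  congr 1
  ext v
  constructor
  · rintro ⟨j, rfl⟩
    exact (G.equivFin.symm j).2
  · intro hv
    exact ⟨G.equivFin ⟨v, hv⟩, by simp⟩

/-- A graded submodule has a minimal system of homogeneous generators. -/
lemma exists_minimal_generators [Finite σ] {n : ℕ} (deg : Fin n → ℕ)
    (K : Submodule (MvPolynomial σ k) (Fin n → MvPolynomial σ k))
    (hK : ∀ b, ∀ v ∈ K, gradedProj deg b v ∈ K) :
    ∃ (m : ℕ) (deg' : Fin m → ℕ)
      (D : (Fin m → MvPolynomial σ k) →ₗ[MvPolynomial σ k] (Fin n → MvPolynomial σ k)),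
      (∀ j, D (Pi.single j 1) ∈ gradedPiece deg (deg' j)) ∧ LinearMap.range D = K ∧
        ∀ v ∈ LinearMap.ker D, ∀ l, constantCoeff (v l) = 0 := by
  classical
  have hex := exists_homogeneous_generators deg K hK
  -- The number of homogeneous generators is taken as small as possible.
  obtain ⟨g, hg, hgK⟩ := Nat.find_spec hex
  have hmin := fun m ↦ Nat.find_min hex (m := m)
  generalize Nat.find hex = m at *
  choose deg' hdeg' using hg
  have hD : ∀ j, Fintype.linearCombination (MvPolynomial σ k) g (Pi.single j 1) = g j := by
    intro j
    rw [Fintype.linearCombination_apply_single, one_smul]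
  have hDdeg : ∀ j, Fintype.linearCombination (MvPolynomial σ k) g (Pi.single j 1) ∈
      gradedPiece deg (deg' j) := fun j ↦ (hD j).symm ▸ hdeg' j
  refine ⟨m, deg', Fintype.linearCombination (MvPolynomial σ k) g, hDdeg,
    by rw [Fintype.range_linearCombination, hgK], fun v hv l ↦ ?_⟩
  by_contra hl
  obtain ⟨m, rfl⟩ : ∃ m', m = m' + 1 := ⟨m - 1, by have := l.2; omega⟩
  -- In degree `deg' l` the `l`-th coefficient of the relation is its constant term, a unit; so `g
  -- l` is redundant, against the minimality of the number of generators.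
  have hw := gradedProj_map hDdeg (deg' l) v
  rw [LinearMap.mem_ker.1 hv, map_zero, Fintype.linearCombination_apply,
    Fin.sum_univ_succAbove _ l, gradedProj_apply, if_pos le_rfl, Nat.sub_self,
    homogeneousComponent_zero] at hw
  generalize gradedProj deg' (deg' l) v = w at hw
  have hunit : C (constantCoeff (v l))⁻¹ * C (coeff 0 (v l)) = (1 : MvPolynomial σ k) := by
    rw [← C_mul, ← constantCoeff_eq, inv_mul_cancel₀ hl, C_1]
  have hgl : g l ∈ Submodule.span (MvPolynomial σ k) (Set.range (g ∘ l.succAbove)) := by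
    have : g l = -((C (constantCoeff (v l))⁻¹ : MvPolynomial σ k) •
        ∑ i, w (l.succAbove i) • g (l.succAbove i)) := by
      rw [eq_neg_iff_add_eq_zero, ← one_smul (MvPolynomial σ k) (g l), ← hunit, mul_smul,
        ← smul_add, ← hw, smul_zero]
    rw [this]
    exact Submodule.neg_mem _ (Submodule.smul_mem _ _ (Submodule.sum_mem _ fun i _ ↦
      Submodule.smul_mem _ _ (Submodule.subset_span ⟨i, rfl⟩)))
  refine hmin m (Nat.lt_succ_self m) ⟨g ∘ l.succAbove, fun j ↦ ⟨_, hdeg' _⟩, ?_⟩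
  refine le_antisymm (hgK ▸ Submodule.span_mono (Set.range_comp_subset_range _ _)) ?_
  rw [← hgK, Submodule.span_le]
  rintro _ ⟨j, rfl⟩
  rcases Fin.eq_self_or_eq_succAbove l j with rfl | ⟨i, rfl⟩
  · exact hgl
  · exact Submodule.subset_span ⟨i, rfl⟩

/-- A graded submodule `K` of a graded free module `F`, contained in `(z_s : s ∈ σ) F`. -/
structure MinimalGradedSubmodule (k σ : Type*) [Field k] where
  /-- the rank of the free module -/
  rank : ℕ
  /-- the degrees of the generators of the free module -/
  deg : Fin rank → ℕ
  /-- the submodule -/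
  K : Submodule (MvPolynomial σ k) (Fin rank → MvPolynomial σ k)
  proj_mem : ∀ b, ∀ v ∈ K, gradedProj deg b v ∈ K
  constantCoeff_eq_zero : ∀ v ∈ K, ∀ l, constantCoeff (v l) = 0

namespace MinimalGradedSubmodule

lemma exists_syzygies [Finite σ] (s : MinimalGradedSubmodule k σ) :
    ∃ (s' : MinimalGradedSubmodule k σ) (D : (Fin s'.rank → MvPolynomial σ k) →ₗ[MvPolynomial σ k]
      (Fin s.rank → MvPolynomial σ k)), (∀ j, D (Pi.single j 1) ∈ gradedPiece s.deg (s'.deg j)) ∧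
        LinearMap.range D = s.K ∧ LinearMap.ker D = s'.K := by
  obtain ⟨m, deg', D, h1, h2, h3⟩ := exists_minimal_generators s.deg s.K s.proj_mem
  refine ⟨⟨m, deg', LinearMap.ker D, fun b v hv ↦ ?_, h3⟩, D, h1, h2, rfl⟩
  rw [LinearMap.mem_ker] at hv ⊢
  rw [← gradedProj_map h1, hv, map_zero]

/-- The module of syzygies of a graded submodule. -/
noncomputable def syzygies [Finite σ] (s : MinimalGradedSubmodule k σ) :
    MinimalGradedSubmodule k σ :=
  s.exists_syzygies.choose

/-- The map from the free module on minimal generators of a graded submodule. -/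
noncomputable def cover [Finite σ] (s : MinimalGradedSubmodule k σ) :
    (Fin s.syzygies.rank → MvPolynomial σ k) →ₗ[MvPolynomial σ k]
      (Fin s.rank → MvPolynomial σ k) :=
  s.exists_syzygies.choose_spec.choose

lemma cover_spec [Finite σ] (s : MinimalGradedSubmodule k σ) :
    (∀ j, s.cover (Pi.single j 1) ∈ gradedPiece s.deg (s.syzygies.deg j)) ∧
      LinearMap.range s.cover = s.K ∧ LinearMap.ker s.cover = s.syzygies.K :=
  s.exists_syzygies.choose_spec.choose_spec

lemma exact_cover [Finite σ] (s : MinimalGradedSubmodule k σ) :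
    Function.Exact s.syzygies.cover s.cover := fun v ↦ by
  rw [← LinearMap.mem_ker, s.cover_spec.2.2, ← s.syzygies.cover_spec.2.1]
  rfl

/-- The iterated syzygies of a graded submodule. -/
noncomputable def iterate [Finite σ] (s : MinimalGradedSubmodule k σ) :
    ℕ → MinimalGradedSubmodule k σ
  | 0 => s
  | i + 1 => (s.iterate i).syzygies

end MinimalGradedSubmodule

/-- A quotient of the polynomial ring by a homogeneous ideal has a minimal graded free
resolution. -/
theorem nonempty_minimalGradedFreeResolution [Finite σ] {R : Type*} [CommRing R] [Algebra k R]
    (φ : MvPolynomial σ k →ₐ[k] R) (𝒜 : ℕ → Submodule k R) (hφ : Function.Surjective φ)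
    (hone : (1 : R) ∈ 𝒜 0)
    (hker : ∀ p, φ p = 0 → ∀ n, φ (homogeneousComponent n p) = 0)
    (hconst : ∀ p, φ p = 0 → constantCoeff p = 0) :
    Nonempty (MinimalGradedFreeResolution φ 𝒜) := by
  let ε : (Fin 1 → MvPolynomial σ k) →ₛₗ[(φ : MvPolynomial σ k →+* R)] R :=
    { toFun := fun v ↦ φ (v 0)
      map_add' := fun v w ↦ by simp
      map_smul' := fun p v ↦ by simp }
  have hε : ∀ v, ε v = φ (v 0) := fun _ ↦ rfl
  have hεone : ∀ j : Fin 1, ε (Pi.single j 1) ∈ 𝒜 0 := fun j ↦ by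
    rw [hε, Subsingleton.elim j 0, Pi.single_eq_same, map_one]
    exact hone
  -- The resolution starts with `F 0 = S`, generated in degree `0`; the iterated syzygies of the
  -- kernel of `φ` give the rest.
  let s : MinimalGradedSubmodule k σ :=
    { rank := 1
      deg := fun _ ↦ 0
      K := LinearMap.ker ε
      proj_mem := fun b v hv ↦ by
        rw [LinearMap.mem_ker, hε] at hv ⊢
        rw [gradedProj_apply, if_pos (Nat.zero_le _)]
        exact hker _ hv _
      constantCoeff_eq_zero := fun v hv l ↦ by
        rw [Subsingleton.elim l 0]
        exact hconst _ hv }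
  exact ⟨{
    rank := fun i ↦ (s.iterate i).rank
    deg := fun i ↦ (s.iterate i).deg
    d := fun i ↦ (s.iterate i).cover
    ε := ε
    ε_mem := hεone
    d_homogeneous := fun i j ↦ mem_gradedPiece.1 ((s.iterate i).cover_spec.1 j)
    ε_surjective := fun r ↦ by
      obtain ⟨p, rfl⟩ := hφ r
      exact ⟨fun _ ↦ p, rfl⟩
    exact_zero := fun v ↦ by
      change v ∈ s.K ↔ _
      rw [← s.cover_spec.2.1]
      rfl
    exact_succ := fun i ↦ (s.iterate i).exact_cover
    minimal := fun i j ↦ (s.iterate i).constantCoeff_eq_zero _ (by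
      rw [← (s.iterate i).cover_spec.2.1]
      exact ⟨_, rfl⟩) }⟩

end Existence

/-! ### The exponents of the monomials in the ring -/

namespace MonomialCurve

/-- The pairs `(p, q)` such that `x ^ p * y ^ q` lies in `k[x ^ α * y ^ (d - α) : α = 0 or
a ≤ α ≤ d]`. -/
def IsExponent (a d p q : ℕ) : Prop :=
  d ∣ p + q ∧ ∃ j, j * a ≤ p ∧ p ≤ j * d

lemma IsExponent.zero (a d : ℕ) : IsExponent a d 0 0 := ⟨by simp, 0, by simp, by simp⟩

lemma IsExponent.add {a d p q p' q' : ℕ} (h : IsExponent a d p q) (h' : IsExponent a d p' q') :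
    IsExponent a d (p + p') (q + q') := by
  obtain ⟨hd, j, h1, h2⟩ := h
  obtain ⟨hd', j', h1', h2'⟩ := h'
  refine ⟨?_, j + j', by rw [add_mul]; omega, by rw [add_mul]; omega⟩
  rw [add_add_add_comm]
  exact dvd_add hd hd'

lemma isExponent_of_mem {a d α : ℕ} (hα : α ∈ ({0} ∪ Finset.Icc a d : Finset ℕ)) :
    IsExponent a d α (d - α) := by
  simp only [Finset.mem_union, Finset.mem_singleton, Finset.mem_Icc] at hα
  rcases hα with rfl | ⟨h1, h2⟩
  · exact ⟨by simp, 0, by simp, by simp⟩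
  · exact ⟨by rw [Nat.add_sub_cancel' h2], 1, by omega, by omega⟩

/-- The interval condition does not see `q`. This is what makes `y^d, x^d` a regular sequence. -/
lemma IsExponent.sub_right {a d p q : ℕ} (h : IsExponent a d p q) (hq : d ≤ q) :
    IsExponent a d p (q - d) := by
  refine ⟨?_, h.2⟩
  rw [← Nat.add_sub_assoc hq]
  exact Nat.dvd_sub h.1 dvd_rfl

/-- Splits a generator off a monomial of positive degree. If `q ≥ d`, take `y^d`. Otherwise `p > nd`
forces `j ≥ n+1`, so `p ≥ (n+1)a`; then `α = a` works if `p - a ≤ nd`, and otherwise `α = p - nd`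
leaves exactly `x^{nd}`. -/
lemma IsExponent.exists_sub {a d p q n : ℕ} (had : a ≤ d) (h : IsExponent a d p q)
    (hn : p + q = (n + 1) * d) :
    ∃ α ∈ ({0} ∪ Finset.Icc a d : Finset ℕ), α ≤ p ∧ d - α ≤ q ∧
      IsExponent a d (p - α) (q - (d - α)) := by
  obtain ⟨hd, j, h1, h2⟩ := h
  simp only [Finset.mem_union, Finset.mem_singleton, Finset.mem_Icc]
  have hdvd : ∀ α, α ≤ d → α ≤ p → d - α ≤ q → d ∣ p - α + (q - (d - α)) := by
    intro α h1 h2 h3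
    rw [show p - α + (q - (d - α)) = n * d by rw [add_mul, one_mul] at hn; omega]
    exact dvd_mul_left _ _
  rw [add_mul, one_mul] at hn
  rcases le_or_gt d q with hq | hq
  · exact ⟨0, Or.inl rfl, by omega, by omega, hdvd 0 (by omega) (by omega) (by omega), j, h1, h2⟩
  · have hj : n + 1 ≤ j := by
      by_contra hj
      have := Nat.mul_le_mul_right d (show j ≤ n by omega)
      omega
    have h3 := Nat.mul_le_mul_right a hj
    have h4 := Nat.mul_le_mul_left n had
    rw [add_mul, one_mul] at h3
    rcases le_or_gt (p - a) (n * d) with h5 | h5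
    · exact ⟨a, Or.inr ⟨le_rfl, had⟩, by omega, by omega,
        hdvd a had (by omega) (by omega), n, by omega, h5⟩
    · exact ⟨p - n * d, Or.inr ⟨by omega, by omega⟩, by omega, by omega,
        hdvd _ (by omega) (by omega) (by omega), n, by omega, by omega⟩

/-- In degrees above `r`, each monomial is divisible by `x ^ d` or by `y ^ d`. -/
lemma IsExponent.sub_of_degree_lt {a d p q n r : ℕ} (hr : d + r * a ≤ r * d + 1)
    (had : a ≤ d) (hr0 : 1 ≤ r) (h : IsExponent a d p q) (hn : p + q = n * d) (hrn : r < n) :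
    (d ≤ p ∧ IsExponent a d (p - d) q) ∨ (d ≤ q ∧ IsExponent a d p (q - d)) := by
  rcases le_or_gt d q with hq | hq
  · exact Or.inr ⟨hq, h.sub_right hq⟩
  · obtain ⟨n, rfl⟩ : ∃ n', n = n' + 1 := ⟨n - 1, by omega⟩
    rw [add_mul, one_mul] at hn
    have h1 := Nat.mul_le_mul_right d (show 1 ≤ n by omega)
    -- The inequality `n(d-a) ≥ d-1` passes from `r` to the lowered `n ≥ r`. With `p ≥ nd + 1` it
    -- gives `p - d ≥ na`, so `j = n` serves for `p - d`.
    have h2 : d + n * a ≤ n * d + 1 := by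
      obtain ⟨e, rfl⟩ := Nat.exists_eq_add_of_le (show r ≤ n by omega)
      have := Nat.mul_le_mul_left e had
      rw [add_mul, add_mul]
      omega
    refine Or.inl ⟨by omega, ?_, n, by omega, by omega⟩
    rw [← Nat.sub_add_comm (by omega)]
    exact Nat.dvd_sub h.1 dvd_rfl

/-- A monomial of degree `r` that is divisible neither by `x ^ d` nor by `y ^ d`. -/
lemma exists_isExponent_of_degree_eq {a d r : ℕ} (hr : d + r * a ≤ r * d + 1)
    (hr' : (r - 1) * d + 1 < d + (r - 1) * a) (had : a < d) (hr0 : 2 ≤ r) :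
    ∃ p q, p + q = r * d ∧ IsExponent a d p q ∧ ¬ (d ≤ p ∧ IsExponent a d (p - d) q) ∧
      ¬ (d ≤ q ∧ IsExponent a d p (q - d)) := by
  obtain ⟨s, rfl⟩ : ∃ s, r = s + 2 := ⟨r - 2, by omega⟩
  simp only [show s + 2 - 1 = s + 1 by omega, add_mul, one_mul] at hr hr' ⊢
  have hs := Nat.mul_le_mul_left s had.le
  -- The extreme case `p = (r-1)d + 1`, `q = d - 1`. Here `p - d = (r-2)d + 1` needs `j ≥ r-1`, but
  -- it is smaller than `(r-1)a`.
  refine ⟨s * d + d + 1, d - 1, by omega, ⟨⟨s + 2, by rw [mul_comm d, add_mul]; omega⟩, s + 2,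
    by rw [add_mul]; omega, by rw [add_mul]; omega⟩, ?_, by omega⟩
  rintro ⟨-, -, j, h1, h2⟩
  have hj : s + 1 ≤ j := by
    by_contra hj
    have := Nat.mul_le_mul_right d (show j ≤ s by omega)
    omega
  have := Nat.mul_le_mul_right a hj
  rw [add_mul] at this
  omega

/-! ### Monomials in the ring -/

variable {k : Type*} [Field k] {a d : ℕ} {E : Finset ℕ}

lemma gen_eq_monomial (p q : ℕ) : (X 0 ^ p * X 1 ^ q : MvPolynomial (Fin 2) k) =
    monomial (Finsupp.single 0 p + Finsupp.single 1 q) 1 := by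
  rw [X_pow_eq_monomial, X_pow_eq_monomial, monomial_mul, one_mul]

lemma eq_single_add_single (m : Fin 2 →₀ ℕ) :
    m = Finsupp.single 0 (m 0) + Finsupp.single 1 (m 1) := by
  ext i
  fin_cases i <;> simp

lemma X_pow_mul_X_pow_mem_ring (had : a ≤ d) (hE : E = {0} ∪ Finset.Icc a d)
    {p q : ℕ} (h : IsExponent a d p q) : (X 0 ^ p * X 1 ^ q : MvPolynomial (Fin 2) k) ∈ ring k d E := by
  obtain ⟨n, hn⟩ := h.1
  rw [mul_comm] at hn
  induction n generalizing p q with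
  | zero =>
    obtain ⟨rfl, rfl⟩ : p = 0 ∧ q = 0 := by omega
    simp
  | succ n ih =>
    obtain ⟨α, hα, h1, h2, h3⟩ := h.exists_sub had hn
    have hαd : α ≤ d := by
      simp only [Finset.mem_union, Finset.mem_singleton, Finset.mem_Icc] at hα
      omega
    have := mul_mem (Algebra.subset_adjoin ⟨α, hE ▸ hα, rfl⟩ : X 0 ^ α * X 1 ^ (d - α) ∈ ring k d E)
      (ih h3 (by rw [add_mul] at hn; omega))
    rw [mul_mul_mul_comm, ← pow_add, ← pow_add, Nat.add_sub_cancel' h1,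
      Nat.add_sub_cancel' h2] at this
    exact this

lemma mem_ring_iff (had : a ≤ d) (hE : E = {0} ∪ Finset.Icc a d)
    {f : MvPolynomial (Fin 2) k} :
    f ∈ ring k d E ↔ ∀ m ∈ f.support, IsExponent a d (m 0) (m 1) := by
  classical
  constructor
  · intro hf
    induction hf using Algebra.adjoin_induction with
    | mem f hf =>
      obtain ⟨α, hα, rfl⟩ := hf
      intro m hm
      rw [gen_eq_monomial] at hm
      obtain rfl := Finset.mem_singleton.1 (support_monomial_subset hm)
      simpa using isExponent_of_mem (hE ▸ hα)
    | algebraMap c =>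
      intro m hm
      obtain rfl := Finset.mem_singleton.1 (support_monomial_subset hm)
      exact IsExponent.zero a d
    | add f g _ _ hf hg =>
      intro m hm
      rcases Finset.mem_union.1 (support_add hm) with h | h
      · exact hf m h
      · exact hg m h
    | mul f g _ _ hf hg =>
      intro m hm
      obtain ⟨u, hu, v, hv, rfl⟩ := Finset.mem_add.1 (support_mul f g hm)
      exact (hf u hu).add (hg v hv)
  · intro h
    rw [f.as_sum]
    refine sum_mem fun m hm ↦ ?_
    have : monomial m (coeff m f) = coeff m f • (X 0 ^ m 0 * X 1 ^ m 1) := by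
      rw [gen_eq_monomial, ← eq_single_add_single, smul_monomial, smul_eq_mul, mul_one]
    rw [this]
    exact Subalgebra.smul_mem _ (X_pow_mul_X_pow_mem_ring had hE (h m hm)) _

lemma eq_sum_smul_monomial (had : a ≤ d) (hE : E = {0} ∪ Finset.Icc a d) (f : ring k d E) :
    f = ∑ m ∈ (f : MvPolynomial (Fin 2) k).support.attach,
      coeff m.1 (f : MvPolynomial (Fin 2) k) • (⟨X 0 ^ m.1 0 * X 1 ^ m.1 1,
        X_pow_mul_X_pow_mem_ring had hE ((mem_ring_iff had hE).1 f.2 m.1 m.2)⟩ :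
          ring k d E) := by
  ext1
  rw [AddSubmonoidClass.coe_finsetSum]
  conv_lhs => rw [(f : MvPolynomial (Fin 2) k).as_sum, ← Finset.sum_attach]
  refine Finset.sum_congr rfl fun m _ ↦ ?_
  rw [Subalgebra.coe_smul]
  dsimp only
  rw [gen_eq_monomial, ← eq_single_add_single, smul_monomial, smul_eq_mul, mul_one]

/-- An ideal contains an element of the ring if it contains its monomials. -/
lemma mem_of_forall_monomial (had : a ≤ d) (hE : E = {0} ∪ Finset.Icc a d)
    (I : Ideal (ring k d E)) {f : ring k d E}
    (h : ∀ m ∈ (f : MvPolynomial (Fin 2) k).support, ∀ g : ring k d E,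
      (g : MvPolynomial (Fin 2) k) = X 0 ^ m 0 * X 1 ^ m 1 → g ∈ I) : f ∈ I := by
  rw [eq_sum_smul_monomial had hE f]
  refine sum_mem fun m _ ↦ ?_
  rw [Algebra.smul_def]
  exact I.mul_mem_left _ (h m.1 m.2 _ rfl)

/-! ### The parameters `x ^ d` and `y ^ d` -/

lemma zero_mem_E (hE : E = {0} ∪ Finset.Icc a d) : 0 ∈ E := by simp [hE]

lemma d_mem_E (had : a ≤ d) (hE : E = {0} ∪ Finset.Icc a d) : d ∈ E := by simp [hE, had]

lemma coe_gen_zero (h : 0 ∈ E) :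
    (gen k d E ⟨0, h⟩ : MvPolynomial (Fin 2) k) = X 1 ^ d := by
  simp [gen]

lemma coe_gen_d (h : d ∈ E) :
    (gen k d E ⟨d, h⟩ : MvPolynomial (Fin 2) k) = X 0 ^ d := by
  simp [gen]

lemma Q_eq_span (h0 : 0 ∈ E) (hd : d ∈ E) :
    Q k d E = Ideal.span {gen k d E ⟨0, h0⟩, gen k d E ⟨d, hd⟩} := by
  unfold Q
  congr 1
  ext f
  rw [Set.mem_ofPred_eq, Set.mem_insert_iff, Set.mem_singleton_iff, Subtype.ext_iff,
    Subtype.ext_iff, coe_gen_zero, coe_gen_d, or_comm]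

lemma support_X_pow_mul {i : Fin 2} {e : ℕ} {f : MvPolynomial (Fin 2) k} {m : Fin 2 →₀ ℕ}
    (hm : m ∈ (X i ^ e * f).support) :
    e ≤ m i ∧ m - Finsupp.single i e ∈ f.support := by
  rw [mem_support_iff, X_pow_eq_monomial, coeff_monomial_mul', one_mul, ite_ne_right_iff] at hm
  exact ⟨by simpa using hm.1 i, mem_support_iff.2 hm.2⟩

/-- The monomials of an element of `Q` are divisible by `x ^ d` or by `y ^ d` in the ring. -/
lemma isExponent_sub_of_mem_Q (had : a ≤ d) (hE : E = {0} ∪ Finset.Icc a d)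
    {f : ring k d E} (hf : f ∈ Q k d E) {m : Fin 2 →₀ ℕ}
    (hm : m ∈ (f : MvPolynomial (Fin 2) k).support) :
    (d ≤ m 0 ∧ IsExponent a d (m 0 - d) (m 1)) ∨ (d ≤ m 1 ∧ IsExponent a d (m 0) (m 1 - d)) := by
  classical
  rw [Q_eq_span (zero_mem_E hE) (d_mem_E had hE), Ideal.mem_span_pair] at hf
  obtain ⟨g, h, rfl⟩ := hf
  rw [Subalgebra.coe_add, Subalgebra.coe_mul, Subalgebra.coe_mul, coe_gen_zero, coe_gen_d,
    mul_comm, mul_comm (h : MvPolynomial (Fin 2) k)] at hm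
  rcases Finset.mem_union.1 (support_add hm) with hm | hm
  · obtain ⟨h1, h2⟩ := support_X_pow_mul hm
    exact Or.inr ⟨h1, by simpa using (mem_ring_iff had hE).1 g.2 _ h2⟩
  · obtain ⟨h1, h2⟩ := support_X_pow_mul hm
    exact Or.inl ⟨h1, by simpa using (mem_ring_iff had hE).1 h.2 _ h2⟩

lemma isExponent_sub_of_X_pow_mul_X_pow_mem_Q (had : a ≤ d) (hE : E = {0} ∪ Finset.Icc a d)
    {p q : ℕ} {h : X 0 ^ p * X 1 ^ q ∈ ring k d E}
    (hQ : (⟨X 0 ^ p * X 1 ^ q, h⟩ : ring k d E) ∈ Q k d E) :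
    (d ≤ p ∧ IsExponent a d (p - d) q) ∨ (d ≤ q ∧ IsExponent a d p (q - d)) := by
  have := isExponent_sub_of_mem_Q had hE hQ
    (m := Finsupp.single 0 p + Finsupp.single 1 q) (by
      dsimp only
      rw [gen_eq_monomial, mem_support_iff, coeff_monomial, if_pos rfl]
      exact one_ne_zero)
  simpa [Finsupp.single_apply] using this

lemma eq_gen_d_mul (had : a ≤ d) (hE : E = {0} ∪ Finset.Icc a d) {p q : ℕ} (hp : d ≤ p)
    (h : IsExponent a d (p - d) q) {g : ring k d E}
    (hg : (g : MvPolynomial (Fin 2) k) = X 0 ^ p * X 1 ^ q) :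
    g = gen k d E ⟨d, d_mem_E had hE⟩ * ⟨_, X_pow_mul_X_pow_mem_ring had hE h⟩ := by
  ext1
  rw [Subalgebra.coe_mul, coe_gen_d, ← mul_assoc, ← pow_add, Nat.add_sub_cancel' hp, hg]

lemma eq_gen_zero_mul (had : a ≤ d) (hE : E = {0} ∪ Finset.Icc a d) {p q : ℕ} (hq : d ≤ q)
    (h : IsExponent a d p (q - d)) {g : ring k d E}
    (hg : (g : MvPolynomial (Fin 2) k) = X 0 ^ p * X 1 ^ q) :
    g = gen k d E ⟨0, zero_mem_E hE⟩ * ⟨_, X_pow_mul_X_pow_mem_ring had hE h⟩ := by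
  ext1
  rw [Subalgebra.coe_mul, coe_gen_zero, mul_left_comm, ← pow_add, Nat.add_sub_cancel' hq, hg]

lemma mem_Q_of_forall (had : a ≤ d) (hE : E = {0} ∪ Finset.Icc a d) {f : ring k d E}
    (h : ∀ m ∈ (f : MvPolynomial (Fin 2) k).support,
      (d ≤ m 0 ∧ IsExponent a d (m 0 - d) (m 1)) ∨
        (d ≤ m 1 ∧ IsExponent a d (m 0) (m 1 - d))) : f ∈ Q k d E := by
  refine mem_of_forall_monomial had hE _ fun m hm g hg ↦ ?_
  rw [Q_eq_span (zero_mem_E hE) (d_mem_E had hE)]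
  rcases h m hm with ⟨h1, h2⟩ | ⟨h1, h2⟩
  · rw [eq_gen_d_mul had hE h1 h2 hg]
    exact Ideal.mul_mem_right _ _ (Ideal.subset_span (by simp))
  · rw [eq_gen_zero_mul had hE h1 h2 hg]
    exact Ideal.mul_mem_right _ _ (Ideal.subset_span (by simp))

lemma gen_zero_mul_eq_zero (h0 : 0 ∈ E) {f : ring k d E} (h : gen k d E ⟨0, h0⟩ * f = 0) :
    f = 0 := by
  have := congrArg (Subtype.val) h
  rw [Subalgebra.coe_mul, coe_gen_zero, ZeroMemClass.coe_zero, mul_eq_zero] at this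
  exact Subtype.ext (this.resolve_left (pow_ne_zero _ (X_ne_zero _)))

/-- If `x^d f = y^d u`, every monomial of `f` has `y`-exponent at least `d`, and `y^d` can be
divided out inside the ring by `IsExponent.sub_right`. -/
lemma mem_span_gen_zero_of_gen_d_mul (had : a ≤ d) (hE : E = {0} ∪ Finset.Icc a d)
    (h0 : 0 ∈ E) (h1 : d ∈ E) {f : ring k d E}
    (h : gen k d E ⟨d, h1⟩ * f ∈ Ideal.span {gen k d E ⟨0, h0⟩}) :
    f ∈ Ideal.span {gen k d E ⟨0, h0⟩} := by
  refine mem_of_forall_monomial had hE _ fun m hm g hg ↦ ?_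
  obtain ⟨u, hu⟩ := Ideal.mem_span_singleton'.1 h
  have hu' := congrArg (Subtype.val) hu
  rw [Subalgebra.coe_mul, Subalgebra.coe_mul, coe_gen_zero, coe_gen_d, mul_comm] at hu'
  have hmem : Finsupp.single 0 d + m ∈ (X 1 ^ d * (u : MvPolynomial (Fin 2) k)).support := by
    rw [hu', mem_support_iff, X_pow_eq_monomial, coeff_monomial_mul, one_mul]
    exact mem_support_iff.1 hm
  have hq : d ≤ m 1 := by simpa using (support_X_pow_mul hmem).1
  rw [eq_gen_zero_mul had hE hq (((mem_ring_iff had hE).1 f.2 m hm).sub_right hq) hg]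
  exact Ideal.mul_mem_right _ _ (Ideal.mem_span_singleton_self _)

/-! ### Powers of the irrelevant ideal -/

lemma gen_mem_irrelevantIdeal (hEd : ∀ α ∈ E, α ≤ d) (α : E) :
    gen k d E α ∈ irrelevantIdeal k d E := by
  refine Ideal.subset_span ⟨1, le_rfl, ?_⟩
  have := (isHomogeneous_X_pow (R := k) (0 : Fin 2) (α : ℕ)).mul (isHomogeneous_X_pow 1 (d - α))
  rw [Nat.add_sub_cancel' (hEd α α.2)] at this
  simpa [component, gen] using this

lemma le_d_of_mem (hE : E = {0} ∪ Finset.Icc a d) : ∀ α ∈ E, α ≤ d := by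
  intro α hα
  simp only [hE, Finset.mem_union, Finset.mem_singleton, Finset.mem_Icc] at hα
  omega

lemma mem_irrelevantIdeal_pow (had : a ≤ d) (hE : E = {0} ∪ Finset.Icc a d) (hd : 0 < d)
    {p q n : ℕ} (h : IsExponent a d p q) (hn : n * d ≤ p + q) {g : ring k d E}
    (hg : (g : MvPolynomial (Fin 2) k) = X 0 ^ p * X 1 ^ q) : g ∈ irrelevantIdeal k d E ^ n := by
  obtain ⟨N, hN⟩ := h.1
  rw [mul_comm] at hN
  have hnN : n ≤ N := Nat.le_of_mul_le_mul_right (hN ▸ hn) hd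
  refine Ideal.pow_le_pow_right hnN ?_
  clear hnN hn
  induction N generalizing p q g with
  | zero => simp
  | succ N ih =>
    obtain ⟨α, hα, h1, h2, h3⟩ := h.exists_sub had hN
    rw [← hE] at hα
    have hαd := le_d_of_mem hE α hα
    rw [pow_succ']
    have hg' : g = gen k d E ⟨α, hα⟩ * ⟨_, X_pow_mul_X_pow_mem_ring had hE h3⟩ := by
      ext1
      rw [Subalgebra.coe_mul, gen, mul_mul_mul_comm, ← pow_add, ← pow_add,
        Nat.add_sub_cancel' h1, Nat.add_sub_cancel' h2, hg]
    rw [hg']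
    exact Ideal.mul_mem_mul (gen_mem_irrelevantIdeal (le_d_of_mem hE) _)
      (ih h3 rfl (by rw [add_mul] at hN; omega))

/-- The irrelevant ideal lies in the contraction of `(x, y)^d`, so its `n`-th power lies in that of
`(x, y)^{nd}`. -/
lemma le_degree_of_mem_irrelevantIdeal_pow {n : ℕ} {f : ring k d E}
    (hf : f ∈ irrelevantIdeal k d E ^ n) {m : Fin 2 →₀ ℕ}
    (hm : m ∈ (f : MvPolynomial (Fin 2) k).support) : n * d ≤ m 0 + m 1 := by
  have hle : irrelevantIdeal k d E ≤
      (idealOfVars (Fin 2) k ^ d).comap (ring k d E).val := by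
    refine Ideal.span_le.2 ?_
    rintro f ⟨n, hn, hf⟩
    refine (mem_pow_idealOfVars_iff _ _).2 fun m hm ↦ ?_
    have : m.degree = n * d := by
      by_contra h
      exact mem_support_iff.1 hm (IsHomogeneous.coeff_eq_zero hf h)
    rw [this]
    exact Nat.le_mul_of_pos_left d hn
  have h := (Ideal.pow_right_mono hle n).trans (Ideal.le_comap_pow _ n) hf
  rw [Ideal.mem_comap, ← pow_mul] at h
  have := (mem_pow_idealOfVars_iff _ _).1 h m hm
  rw [mul_comm]
  simpa [Finsupp.degree_eq_sum] using this

/-- The reduction number of the irrelevant ideal with respect to `(x ^ d, y ^ d)`. -/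
theorem isReductionNumber_Q {r : ℕ} (had : a < d) (hE : E = {0} ∪ Finset.Icc a d)
    (hr : d + r * a ≤ r * d + 1) (hr' : (r - 1) * d + 1 < d + (r - 1) * a) (hr0 : 2 ≤ r) :
    IsReductionNumber (Q k d E) (irrelevantIdeal k d E) r := by
  have hd : 0 < d := by omega
  have hQI : Q k d E ≤ irrelevantIdeal k d E := by
    rw [Q_eq_span (zero_mem_E hE) (d_mem_E had.le hE), Ideal.span_le]
    rintro _ (rfl | rfl) <;> exact gen_mem_irrelevantIdeal (le_d_of_mem hE) _
  refine ⟨hQI, ?_, fun s hs ↦ ?_⟩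
  · refine le_antisymm ((Ideal.mul_mono_left hQI).trans_eq (pow_succ' _ _).symm) fun f hf ↦ ?_
    refine mem_of_forall_monomial had.le hE _ fun m hm g hg ↦ ?_
    have hdeg := le_degree_of_mem_irrelevantIdeal_pow hf hm
    have hexp := (mem_ring_iff had.le hE).1 f.2 m hm
    obtain ⟨n, hn⟩ := hexp.1
    rw [mul_comm] at hn
    have hrn : r < n := Nat.le_of_mul_le_mul_right (hn ▸ hdeg) hd
    rw [add_mul, one_mul] at hdeg
    rw [Q_eq_span (zero_mem_E hE) (d_mem_E had.le hE)]
    rcases hexp.sub_of_degree_lt hr had.le (by omega) hn hrn with ⟨h1, h2⟩ | ⟨h1, h2⟩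
    · rw [eq_gen_d_mul had.le hE h1 h2 hg]
      exact Ideal.mul_mem_mul (Ideal.subset_span (by simp))
        (mem_irrelevantIdeal_pow had.le hE hd h2 (by omega) rfl)
    · rw [eq_gen_zero_mul had.le hE h1 h2 hg]
      exact Ideal.mul_mem_mul (Ideal.subset_span (by simp))
        (mem_irrelevantIdeal_pow had.le hE hd h2 (by omega) rfl)
  · by_contra hlt
    -- An equality `Q I^s = I^(s+1)` with `s < r` would give `I^r ⊆ I^(s+1) ⊆ Q`, which the
    -- surviving monomial of degree `r` contradicts.
    obtain ⟨p, q, hpq, hexp, h1, h2⟩ := exists_isExponent_of_degree_eq hr hr' had hr0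
    have hmem := mem_irrelevantIdeal_pow had.le hE hd hexp hpq.ge
      (g := (⟨_, X_pow_mul_X_pow_mem_ring had.le hE hexp⟩ : ring k d E)) rfl
    have hle : irrelevantIdeal k d E ^ r ≤ Q k d E :=
      (Ideal.pow_le_pow_right (show s + 1 ≤ r by omega)).trans
        (hs.ge.trans Ideal.mul_le_left)
    exact (isExponent_sub_of_X_pow_mul_X_pow_mem_Q had.le hE (hle hmem)).elim h1 h2

end MonomialCurve

/-! ### Finite flat extensions of factorial domains of dimension at most two -/

section CohenMacaulay

open RingTheory.Sequence

lemma ringKrullDim_le_of_isIntegral (A B : Type*) [CommRing A] [CommRing B] [Algebra A B]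
    [Algebra.IsIntegral A B] : ringKrullDim B ≤ ringKrullDim A :=
  Order.krullDim_le_of_strictMono (fun p ↦ PrimeSpectrum.comap (algebraMap A B) p)
    fun p _ h ↦ Ideal.IsIntegral.comap_lt_comap (I := p.asIdeal) h

/-- A weakly regular sequence inside `p` becomes regular in the localization, whose dimension is the
height of `p`. -/
lemma isCohenMacaulayLocal_localization_of_isWeaklyRegular {R : Type*} [CommRing R]
    [IsNoetherianRing R] (p : Ideal R) [p.IsPrime] (rs : List R) (hp : ∀ r ∈ rs, r ∈ p)
    (hreg : IsWeaklyRegular R rs) (hlen : (rs.length : ℕ∞) = p.height) :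
    IsCohenMacaulayLocal (Localization.AtPrime p) := by
  refine ⟨IsLocalization.isNoetherianRing p.primeCompl _ inferInstance,
    rs.map (algebraMap R (Localization.AtPrime p)), ?_,
    hreg.isRegular_of_isLocalization_of_mem (Localization.AtPrime p) p hp, ?_⟩
  · intro r hr
    obtain ⟨s, hs, rfl⟩ := List.mem_map.1 hr
    exact (IsLocalization.AtPrime.to_map_mem_maximal_iff (Localization.AtPrime p) p s).2 (hp s hs)
  · rw [List.length_map, IsLocalization.AtPrime.ringKrullDim_eq_height p, ← hlen]
    rfl

open scoped Pointwise in
/-- A prime element and an element outside of the ideal it generates form a weakly regular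
sequence. -/
lemma isWeaklyRegular_pair_of_prime {P : Type*} [CommRing P] [IsDomain P] {f g : P}
    (hf : Prime f) (hg : g ∉ Ideal.span {f}) : IsWeaklyRegular P [f, g] := by
  have hprime : (Ideal.span {f}).IsPrime := (Ideal.span_singleton_prime hf.ne_zero).2 hf
  refine IsWeaklyRegular.cons ?_ ((isWeaklyRegular_singleton_iff _ _).2 ?_)
  · intro x y hxy
    exact mul_left_cancel₀ hf.ne_zero hxy
  · intro x y hxy
    obtain ⟨x, rfl⟩ := Submodule.Quotient.mk_surjective _ x
    obtain ⟨y, rfl⟩ := Submodule.Quotient.mk_surjective _ y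
    have hmem : ∀ z, z ∈ (f • ⊤ : Submodule P P) ↔ z ∈ Ideal.span {f} := by
      intro z
      rw [← Submodule.ideal_span_singleton_smul]
      simp
    simp only [← Submodule.Quotient.mk_smul] at hxy
    rw [Submodule.Quotient.eq, hmem] at hxy ⊢
    rw [← smul_sub, smul_eq_mul] at hxy
    exact (hprime.mem_or_mem hxy).resolve_left hg

/-- A domain that is finite and flat over a Noetherian factorial domain of dimension at most two
is Cohen-Macaulay. -/
theorem isCohenMacaulay_of_finite_of_flat (P R : Type*) [CommRing P] [IsDomain P]
    [UniqueFactorizationMonoid P] [IsNoetherianRing P] [CommRing R] [IsDomain R] [Algebra P R]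
    [Module.Finite P R] [Module.Flat P R] (hP : ringKrullDim P ≤ 2) : IsCohenMacaulay R := by
  have hR : IsNoetherianRing R := IsNoetherianRing.of_finite P R
  refine ⟨hR, fun p hp ↦ ?_⟩
  have hle : p.height ≤ 2 := by
    have h := (Ideal.height_le_ringKrullDim_of_ne_top hp.ne_top).trans
      ((ringKrullDim_le_of_isIntegral P R).trans hP)
    exact WithBot.coe_le_coe.1 h
  rcases eq_or_ne p ⊥ with rfl | hne
  · exact isCohenMacaulayLocal_localization_of_isWeaklyRegular _ [] (by simp) (.nil R R)
      (by simp)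
  by_cases h1 : 1 < p.height
  · have h2 : p.height = 2 := le_antisymm hle (Order.add_one_le_of_lt h1)
    have h3 := PrimeSpectrum.height_eq_orderHeight (⟨p, hp⟩ : PrimeSpectrum R)
    rw [show (⟨p, hp⟩ : PrimeSpectrum R).asIdeal = p from rfl] at h3
    rw [h3, Order.one_lt_height_iff] at h1
    obtain ⟨q, q', hq', hq⟩ := h1
    -- By incomparability the chain below `p` stays strict in `P`. The contraction of `q` is then
    -- nonzero and contains a prime element `f`; any `g` in the contraction of `p` outside that of
    -- `q` completes the sequence, which flatness carries to `R`.
    have hlt : q.asIdeal.comap (algebraMap P R) < p.comap (algebraMap P R) :=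
      Ideal.IsIntegral.comap_lt_comap hq
    have hlt' : q'.asIdeal.comap (algebraMap P R) < q.asIdeal.comap (algebraMap P R) :=
      Ideal.IsIntegral.comap_lt_comap hq'
    obtain ⟨f, hfq, hf⟩ := (inferInstance : (q.asIdeal.comap (algebraMap P R)).IsPrime)
      |>.exists_mem_prime_of_ne_bot (bot_le.trans_lt hlt').ne'
    obtain ⟨g, hgp, hgq⟩ := SetLike.exists_of_lt hlt
    have hg : g ∉ Ideal.span {f} := fun h ↦
      hgq ((Ideal.span_singleton_le_iff_mem _).2 hfq h)
    refine isCohenMacaulayLocal_localization_of_isWeaklyRegular p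
      ([f, g].map (algebraMap P R)) ?_ (isWeaklyRegular_pair_of_prime hf hg).of_flat ?_
    · simpa using ⟨hlt.le hfq, hgp⟩
    · rw [h2]; rfl
  · obtain ⟨f, hf, hf0⟩ := Submodule.exists_mem_ne_zero_of_ne_bot hne
    refine isCohenMacaulayLocal_localization_of_isWeaklyRegular p [f] (by simpa using hf)
      ((isWeaklyRegular_singleton_iff _ _).2 fun x y hxy ↦ mul_left_cancel₀ hf0 hxy) ?_
    refine le_antisymm (Order.one_le_iff_ne_zero.2 ?_) (not_lt.1 h1)
    exact Ideal.height_eq_zero_iff_eq_bot.not.2 hne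

end CohenMacaulay

/-! ### The ring is free over `k[x ^ d, y ^ d]` -/

namespace MonomialCurve

/-- For each residue class modulo `d` there is an exponent such that the other exponents of that
class arise from it by adding multiples of `d`. -/
lemma exists_minimal_isExponent {a d ρ : ℕ} (had : a < d) (hρ : ρ < d) :
    ∃ p q, IsExponent a d p q ∧ p % d = ρ ∧ ∀ p' q', IsExponent a d p' q' → p' % d = ρ →
      ∃ s t, p' = d * s + p ∧ q' = d * t + q := by
  classical
  have hex : ∃ p, p % d = ρ ∧ ∃ j, j * a ≤ p ∧ p ≤ j * d := by
    -- The interval `[da, d²]` contains every residue class modulo `d`, because `a ≤ d - 1`.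
    refine ⟨ρ + d * (d - 1), by rw [Nat.add_mul_mod_self_left, Nat.mod_eq_of_lt hρ], d, ?_, ?_⟩
    · have := Nat.mul_le_mul_left d (show a ≤ d - 1 by omega)
      omega
    · rw [Nat.mul_sub, mul_one]
      have := Nat.le_mul_self d
      omega
  obtain ⟨hp, hj⟩ := Nat.find_spec hex
  have hmin : ∀ p', (p' % d = ρ ∧ ∃ j, j * a ≤ p' ∧ p' ≤ j * d) → Nat.find hex ≤ p' :=
    fun p' h ↦ Nat.find_min' hex h
  generalize Nat.find hex = p at *
  -- The residue of `q'` is forced to be that of `-ρ`, so the least `p` and the least `q` of the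
  -- class can be attained together.
  have hmod : ∀ p' q', p' % d = ρ → d ∣ p' + q' → q' % d = if ρ = 0 then 0 else d - ρ := by
    intro p' q' h1 h2
    have h3 : d ∣ ρ + q' % d := by
      rw [← h1]
      exact (Nat.dvd_iff_mod_eq_zero).2 ((Nat.add_mod p' q' d) ▸ Nat.mod_eq_zero_of_dvd h2)
    have h4 := Nat.mod_lt q' (show 0 < d by omega)
    obtain ⟨c, hc⟩ := h3
    have hc2 : c < 2 := by
      by_contra h
      have := Nat.mul_le_mul_left d (show 2 ≤ c by omega)
      omega
    split_ifs with h0 <;> interval_cases c <;> omega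
  refine ⟨p, if ρ = 0 then 0 else d - ρ, ⟨?_, hj⟩, hp, fun p' q' h h' ↦ ?_⟩
  · rw [Nat.dvd_iff_mod_eq_zero, Nat.add_mod, hp]
    split_ifs with h0
    · simp [h0]
    · rw [Nat.mod_eq_of_lt (show d - ρ < d by omega), Nat.add_sub_cancel' hρ.le, Nat.mod_self]
  · have h1 := hmin p' ⟨h', h.2⟩
    have h2 := Nat.div_add_mod q' d
    rw [hmod p' q' h' h.1] at h2
    obtain ⟨s, hs⟩ := (Nat.modEq_iff_dvd' h1).1 (hp.trans h'.symm)
    exact ⟨s, q' / d, by omega, h2.symm⟩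

variable {k : Type*} [Field k] {a d : ℕ} {E : Finset ℕ}

/-- The embedding of `k[u, v]` with `u ↦ x ^ d` and `v ↦ y ^ d`. -/
noncomputable def parameterMap (k : Type*) [Field k] (d : ℕ) (E : Finset ℕ) (h0 : 0 ∈ E)
    (h1 : d ∈ E) : MvPolynomial (Fin 2) k →ₐ[k] ring k d E :=
  aeval ![gen k d E ⟨d, h1⟩, gen k d E ⟨0, h0⟩]

lemma coe_parameterMap (h0 : 0 ∈ E) (h1 : d ∈ E) (f : MvPolynomial (Fin 2) k) :
    (parameterMap k d E h0 h1 f : MvPolynomial (Fin 2) k) = expand d f := by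
  have : (ring k d E).val.comp (parameterMap k d E h0 h1) = expand d := by
    ext1 i
    fin_cases i
    · simp [parameterMap, coe_gen_d]
    · simp [parameterMap, coe_gen_zero]
  exact DFunLike.congr_fun this f

/-- The ring is a finite free module over `k[x ^ d, y ^ d]`. -/
lemma nonempty_basis (had : a < d) (hE : E = {0} ∪ Finset.Icc a d) (h0 : 0 ∈ E) (h1 : d ∈ E) :
    letI := (parameterMap k d E h0 h1).toRingHom.toAlgebra
    Nonempty (Module.Basis (Fin d) (MvPolynomial (Fin 2) k) (ring k d E)) := by
  let := (parameterMap k d E h0 h1).toRingHom.toAlgebra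
  have hsmul : ∀ (f : MvPolynomial (Fin 2) k) (g : ring k d E),
      ((f • g : ring k d E) : MvPolynomial (Fin 2) k) = expand d f * g := by
    intro f g
    rw [← coe_parameterMap h0 h1]
    rfl
  choose p q hexp hmod hdiv using fun ρ : Fin d ↦ exists_minimal_isExponent had ρ.2
  let v : Fin d → ring k d E := fun ρ ↦
    ⟨X 0 ^ p ρ * X 1 ^ q ρ, X_pow_mul_X_pow_mem_ring had.le hE (hexp ρ)⟩
  have hv : ∀ ρ, (v ρ : MvPolynomial (Fin 2) k) = X 0 ^ p ρ * X 1 ^ q ρ := fun _ ↦ rfl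
  refine ⟨Module.Basis.mk (v := v) ?_ ?_⟩
  · rw [Fintype.linearIndependent_iff]
    intro c hc ρ
    ext m
    -- Coefficients over `k[x^d, y^d]` only shift exponents by multiples of `d`, and the basis
    -- monomials have distinct residues of `p`; so only the `ρ`-th summand contributes to this
    -- coefficient.
    have hc' := congrArg (fun f : ring k d E ↦ coeff
      (d • m + (Finsupp.single 0 (p ρ) + Finsupp.single 1 (q ρ)))
        (f : MvPolynomial (Fin 2) k)) hc
    simp only [AddSubmonoidClass.coe_finsetSum, hsmul, hv, gen_eq_monomial, coeff_sum,
      ZeroMemClass.coe_zero, coeff_zero] at hc'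
    rw [Finset.sum_eq_single ρ, coeff_mul_monomial, mul_one,
      coeff_expand_smul _ (show d ≠ 0 by omega)] at hc'
    · rw [hc', coeff_zero]
    · intro ρ' _ hne
      rw [coeff_mul_monomial', mul_one]
      split_ifs with hle
      · refine coeff_expand_of_not_dvd _ (i := 0) fun hdvd ↦ hne ?_
        have hle0 : p ρ' ≤ d * m 0 + p ρ := by simpa using hle 0
        have hdvd' : d ∣ d * m 0 + p ρ - p ρ' := by simpa using hdvd
        have := (Nat.modEq_iff_dvd' hle0).2 hdvd'
        rw [Nat.ModEq, hmod, Nat.mul_add_mod, hmod] at this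
        exact Fin.ext this
      · rfl
    · simp
  · intro f _
    have hmono : ∀ m ∈ (f : MvPolynomial (Fin 2) k).support, ∀ g : ring k d E,
        (g : MvPolynomial (Fin 2) k) = X 0 ^ m 0 * X 1 ^ m 1 →
          g ∈ Submodule.span (MvPolynomial (Fin 2) k) (Set.range v) := by
      intro m hm g hg
      let ρ : Fin d := ⟨m 0 % d, Nat.mod_lt _ (by omega)⟩
      obtain ⟨s, t, hs, ht⟩ := hdiv ρ _ _ ((mem_ring_iff had.le hE).1 f.2 m hm) rfl
      have : g = (X 0 ^ s * X 1 ^ t : MvPolynomial (Fin 2) k) • v ρ := by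
        ext1
        rw [hsmul, hv, hg, hs, ht]
        simp only [map_mul, map_pow, expand_X]
        ring
      rw [this]
      exact Submodule.smul_mem _ _ (Submodule.subset_span ⟨ρ, rfl⟩)
    rw [eq_sum_smul_monomial had.le hE f]
    refine Submodule.sum_mem _ fun m _ ↦ ?_
    have hk : ∀ (c : k) (g : ring k d E), c • g = (C c : MvPolynomial (Fin 2) k) • g := by
      intro c g
      ext1
      rw [hsmul, expand_C, Subalgebra.coe_smul, smul_eq_C_mul]
    rw [hk]
    exact Submodule.smul_mem _ _ (hmono m.1 m.2 _ rfl)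

/-- The ring is Cohen-Macaulay. -/
theorem isCohenMacaulay_ring (had : a < d) (hE : E = {0} ∪ Finset.Icc a d) :
    IsCohenMacaulay (ring k d E) := by
  let := (parameterMap k d E (zero_mem_E hE) (d_mem_E had.le hE)).toRingHom.toAlgebra
  obtain ⟨b⟩ := nonempty_basis (k := k) had hE (zero_mem_E hE) (d_mem_E had.le hE)
  have : Module.Finite (MvPolynomial (Fin 2) k) (ring k d E) := .of_basis b
  have : Module.Free (MvPolynomial (Fin 2) k) (ring k d E) := .of_basis b
  refine isCohenMacaulay_of_finite_of_flat (MvPolynomial (Fin 2) k) _ ?_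
  simp

end MonomialCurve

/-! ### The presentation of the ring and its regularity -/

namespace MonomialCurve

variable {k : Type*} [Field k] {a d : ℕ} {E : Finset ℕ}

lemma coe_presentation (p : MvPolynomial E k) :
    (presentation k d E p : MvPolynomial (Fin 2) k) =
      aeval (fun α : E ↦ (X 0 ^ (α : ℕ) * X 1 ^ (d - (α : ℕ)) : MvPolynomial (Fin 2) k)) p := by
  have : (ring k d E).val.comp (presentation k d E) =
      aeval fun α : E ↦ (X 0 ^ (α : ℕ) * X 1 ^ (d - (α : ℕ)) : MvPolynomial (Fin 2) k) := by
    ext1 α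
    simp [presentation, gen]
  exact DFunLike.congr_fun this p

lemma presentation_surjective : Function.Surjective (presentation k d E) := by
  rintro ⟨f, hf⟩
  have hrange : {f | ∃ α ∈ E, f = X 0 ^ α * X 1 ^ (d - α)} = Set.range
      (fun α : E ↦ (X 0 ^ (α : ℕ) * X 1 ^ (d - (α : ℕ)) : MvPolynomial (Fin 2) k)) := by
    ext f
    simp [eq_comm]
  have hf' := hf
  rw [ring, hrange, Algebra.adjoin_range_eq_range_aeval] at hf'
  obtain ⟨p, hp⟩ := hf'
  exact ⟨p, Subtype.ext ((coe_presentation p).trans hp)⟩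

lemma mem_component {n : ℕ} {f : ring k d E} :
    f ∈ component k d E n ↔ (f : MvPolynomial (Fin 2) k).IsHomogeneous (n * d) := Iff.rfl

lemma presentation_mem_component (hEd : ∀ α ∈ E, α ≤ d) {n : ℕ} {p : MvPolynomial E k}
    (hp : p.IsHomogeneous n) : presentation k d E p ∈ component k d E n := by
  rw [mem_component, coe_presentation, mul_comm]
  refine hp.aeval _ fun α ↦ ?_
  have := (isHomogeneous_X_pow (R := k) (0 : Fin 2) (α : ℕ)).mul (isHomogeneous_X_pow 1 (d - α))
  rwa [Nat.add_sub_cancel' (hEd α α.2)] at this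

/-- The presentation multiplies degrees by `d > 0`, so distinct degrees stay distinct. This shows
that its kernel is a homogeneous ideal. -/
lemma coe_presentation_homogeneousComponent (hEd : ∀ α ∈ E, α ≤ d) (hd : 0 < d) (n : ℕ)
    (p : MvPolynomial E k) :
    (presentation k d E (homogeneousComponent n p) : MvPolynomial (Fin 2) k) =
      homogeneousComponent (n * d) (presentation k d E p : MvPolynomial (Fin 2) k) := by
  have h : ∀ i, homogeneousComponent (n * d)
      (presentation k d E (homogeneousComponent i p) : MvPolynomial (Fin 2) k) =
        if i = n then (presentation k d E (homogeneousComponent i p) : MvPolynomial (Fin 2) k)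
        else 0 := by
    intro i
    refine (homogeneousComponent_of_mem (presentation_mem_component hEd
      (homogeneousComponent_isHomogeneous i p))).trans ?_
    simp [hd.ne', eq_comm]
  conv_rhs => rw [← sum_homogeneousComponent p, map_sum, AddSubmonoidClass.coe_finsetSum, map_sum]
  rw [Finset.sum_congr rfl fun i _ ↦ h i, Finset.sum_ite_eq' (Finset.range (p.totalDegree + 1)) n]
  split_ifs with hn
  · rfl
  · rw [homogeneousComponent_eq_zero _ _ (by simpa using hn), map_zero, ZeroMemClass.coe_zero]

/-- The regularity of the ring is the top degree of its quotient by `x ^ d` and `y ^ d`. -/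
theorem hasRegularity_presentation {r : ℕ} (had : a < d) (hE : E = {0} ∪ Finset.Icc a d)
    (hr : d + r * a ≤ r * d + 1) (hr' : (r - 1) * d + 1 < d + (r - 1) * a) (hr0 : 2 ≤ r) :
    HasRegularity (presentation k d E) (component k d E) r := by
  have hd : 0 < d := by omega
  have hEd := le_d_of_mem hE
  have h0 := zero_mem_E hE
  have h1 := d_mem_E had.le hE
  have hφ : ∀ α, presentation k d E (X α) = gen k d E α := fun α ↦ by simp [presentation]
  constructor
  · refine nonempty_minimalGradedFreeResolution _ _ presentation_surjective ?_ ?_ ?_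
    · simpa [mem_component] using isHomogeneous_one (Fin 2) k
    · intro p hp n
      ext1
      rw [coe_presentation_homogeneousComponent hEd hd, hp, ZeroMemClass.coe_zero, map_zero]
    · intro p hp
      -- No generator is a constant, since `α` and `d - α` are not both zero; hence the presentation
      -- preserves constant terms.
      have hc : (constantCoeff.comp (ring k d E).val.toRingHom).comp
          (presentation k d E).toRingHom = constantCoeff := by
        refine ringHom_ext (fun c ↦ ?_) fun α ↦ ?_
        · simp [presentation, constantCoeff_eq]
        · have : (α : ℕ) ≠ 0 ∨ d - (α : ℕ) ≠ 0 := by omega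
          simpa [presentation, gen] using this
      have := RingHom.congr_fun hc p
      rw [← this]
      change constantCoeff ((presentation k d E p : ring k d E) : MvPolynomial (Fin 2) k) = 0
      rw [hp, ZeroMemClass.coe_zero, map_zero]
  · intro F
    refine F.isGreatest_of_regular_pair (s := ⟨0, h0⟩) (t := ⟨d, h1⟩)
      (fun n p hp ↦ presentation_mem_component hEd hp) (fun i j x y hx hy ↦ ?_)
      (fun h ↦ hd.ne (congrArg Subtype.val h)) (fun x hx ↦ ?_) (fun x hx ↦ ?_)
      (fun b x hb hx ↦ ?_) ?_ ?_
    · rw [mem_component, add_mul]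
      exact IsHomogeneous.mul hx hy
    · rw [hφ] at hx
      exact gen_zero_mul_eq_zero h0 hx
    · rw [hφ, hφ] at *
      exact mem_span_gen_zero_of_gen_d_mul had.le hE h0 h1 hx
    · rw [hφ, hφ, ← Q_eq_span h0 h1]
      refine mem_Q_of_forall had.le hE fun m hm ↦ ?_
      refine ((mem_ring_iff had.le hE).1 x.2 m hm).sub_of_degree_lt hr had.le (by omega) ?_ hb
      have : m.degree = b * d := by
        by_contra h
        exact mem_support_iff.1 hm (IsHomogeneous.coeff_eq_zero hx h)
      simpa [Finsupp.degree_eq_sum] using this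
    · rw [hφ, hφ, ← Q_eq_span h0 h1]
      obtain ⟨p, q, hpq, hexp, h⟩ := exists_isExponent_of_degree_eq hr hr' had hr0
      refine ⟨⟨_, X_pow_mul_X_pow_mem_ring had.le hE hexp⟩, ?_, fun hQ ↦ ?_⟩
      · rw [mem_component, ← hpq]
        exact (isHomogeneous_X_pow _ _).mul (isHomogeneous_X_pow _ _)
      · exact not_or.2 h (isExponent_sub_of_X_pow_mul_X_pow_mem_Q had.le hE hQ)
    -- The projection takes the component of degree `rd` in `x, y`; it stays in the ring because
    -- membership is decided monomial by monomial.
    · refine ⟨AddMonoidHom.mk' (fun f ↦ ⟨homogeneousComponent (r * d) (f : MvPolynomial (Fin 2) k),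
        (mem_ring_iff had.le hE).2 fun m hm ↦ (mem_ring_iff had.le hE).1 f.2 m ?_⟩)
        fun f g ↦ Subtype.ext (by simp), fun x hx ↦ Subtype.ext ?_,
        fun b hb x hx ↦ Subtype.ext ?_⟩
      · classical
        rw [support_homogeneousComponent] at hm
        exact (Finset.mem_filter.1 hm).1
      · exact homogeneousComponent_eq_self hx
      · refine (homogeneousComponent_of_mem hx).trans (if_neg fun h ↦ hb ?_)
        exact (Nat.eq_of_mul_eq_mul_right hd h).symm

end MonomialCurve

/-- With `r` the ceiling, the first two inequalities are `d-1 ≤ r(d-a)` and `(r-1)(d-a) < d-1`,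
rearranged to avoid the difference `d - a` in `ℕ`. The bound `2 ≤ r` comes from `a > 1`, which makes
the quotient exceed `1`. -/
lemma ceil_div_bounds {a d : ℕ} (ha : 1 < a) (had : a < d) :
    d + ⌈((d : ℚ) - 1) / ((d : ℚ) - (a : ℚ))⌉₊ * a ≤
        ⌈((d : ℚ) - 1) / ((d : ℚ) - (a : ℚ))⌉₊ * d + 1 ∧
      (⌈((d : ℚ) - 1) / ((d : ℚ) - (a : ℚ))⌉₊ - 1) * d + 1 <
        d + (⌈((d : ℚ) - 1) / ((d : ℚ) - (a : ℚ))⌉₊ - 1) * a ∧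
      2 ≤ ⌈((d : ℚ) - 1) / ((d : ℚ) - (a : ℚ))⌉₊ := by
  have ha' : (1 : ℚ) < a := by exact_mod_cast ha
  have hda : (0 : ℚ) < (d : ℚ) - a := sub_pos.2 (by exact_mod_cast had)
  have hr : 1 < ⌈((d : ℚ) - 1) / ((d : ℚ) - (a : ℚ))⌉₊ := by
    rw [Nat.lt_ceil, Nat.cast_one, lt_div_iff₀ hda]
    linarith
  have h1 := Nat.le_ceil (((d : ℚ) - 1) / ((d : ℚ) - (a : ℚ)))
  have h2 := Nat.lt_ceil.1 (Nat.sub_one_lt (show ⌈((d : ℚ) - 1) / ((d : ℚ) - (a : ℚ))⌉₊ ≠ 0 by omega))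
  generalize ⌈((d : ℚ) - 1) / ((d : ℚ) - (a : ℚ))⌉₊ = r at *
  rw [div_le_iff₀ hda] at h1
  rw [lt_div_iff₀ hda] at h2
  refine ⟨?_, ?_, hr⟩
  · rw [← Nat.cast_le (α := ℚ)]
    push_cast
    linarith
  · rw [← Nat.cast_lt (α := ℚ)]
    push_cast
    linarith

theorem mainTheorem4 {k : Type*} [Field k] (a d : ℕ) (ha : 1 < a) (had : a < d)
    (E : Finset ℕ) (hE : E = {0} ∪ Finset.Icc a d) :
    IsCohenMacaulay (MonomialCurve.ring k d E) ∧
      HasRegularity (MonomialCurve.presentation k d E) (MonomialCurve.component k d E)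
        ⌈((d : ℚ) - 1) / ((d : ℚ) - (a : ℚ))⌉ ∧
      IsReductionNumber (MonomialCurve.Q k d E) (MonomialCurve.irrelevantIdeal k d E)
        ⌈((d : ℚ) - 1) / ((d : ℚ) - (a : ℚ))⌉₊ := by
  obtain ⟨hr, hr', hr0⟩ := ceil_div_bounds ha had
  refine ⟨MonomialCurve.isCohenMacaulay_ring had hE, ?_,
    MonomialCurve.isReductionNumber_Q had hE hr hr' hr0⟩
  -- The quotient is nonnegative, so the integer and natural ceilings agree.
  rw [← Int.natCast_ceil_eq_ceil_of_neg_one_lt]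
  · exact MonomialCurve.hasRegularity_presentation had hE hr hr' hr0
  · have h1 : (1 : ℚ) < d := by exact_mod_cast ha.trans had
    have h2 : (a : ℚ) < d := by exact_mod_cast had
    exact (by norm_num : (-1 : ℚ) < 0).trans_le (div_nonneg (by linarith) (by linarith))
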